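/- **Setting.** Let $M=\mathbb R\times N$ be a space-time split by a global time function, where $N$ is a second countable Hausdorff smooth manifold, with a locally finite measure of full support (e.g. given by a volume form). A closed set $K\subset M$ is *spatially compact* if $K\cap([t',t]\times N)$ is compact for all $t',t$. For a smooth vector bundle $E\to M$, $\Gamma(E)$ denotes the smooth sections, $\Gamma_0(E)$ those with compact support, and $\Gamma_+(E)$ (advanced) resp. $\Gamma_-(E)$ (retarded) those with spatially compact support contained in $[t,\infty)\times N$ resp. $(-\infty,t]\times N$ for some $t$. The contraction of dual sections includes integration over $M$. Let $B,E,F\to M$ be smooth vector bundles, and let $\mathcal M=\Gamma(B)$ be the space of fields $\varphi$. A map defined on $\mathcal M$ is called smooth if it takes finite-dimensional smooth families of fields to smooth families, and local if it is smooth and its value at $x\in M$ depends only on the jets of its arguments at $x$ of some fixed finite order. Let $T:\mathcal M\to\Gamma(E)$ be local, $\Sigma=\{\varphi: T[\varphi]=0\}$ the shell, $\approx$ equality on $\Sigma$, and $J_{ai}=T_{a,i}$ the linearization of $T$. Let $R[\varphi]:\Gamma(F)\to\Gamma(B)$ and $V[\varphi]:\Gamma(E^*)\to\Gamma(B)$ be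 linear differential operators depending locally on $\varphi$, regarded as collections $R_\alpha$, $V_a$ of vector fields on $\mathcal M$. Assume: 1. (regularity) $\Sigma$ is a smooth submanifold with tangent spaces $\operatorname{Ker}J$: for $\varphi\in\Sigma$, each $X\in\Gamma(B)$ with spatially compact support and $J[\varphi]X=0$ is the velocity at $\varphi$ of a smooth curve in $\Sigma$; 2. (gauge symmetry) $R_\alpha T_a=C_{\alpha a}^bT_b$ with local $C_{\alpha a}^b$; 3. (completeness) for each $\varphi\in\Sigma$ and each sign, the sequences $\Gamma_\pm(F)\xrightarrow{R}\Gamma_\pm(B)\xrightarrow{J}\Gamma_\pm(E)$ and $\Gamma_\pm(E^*)\xrightarrow{J^*}\Gamma_\pm(B^*)\xrightarrow{R^*}\Gamma_\pm(F^*)$ are exact at the middle term; 4. ($V$ is a Lagrange anchor with local structure functions) there are local $C_{ab}^d$, $D_{ab}^\alpha$, $W_a^{ij}$ with $V_aT_b-V_bT_a=C_{ab}^dT_d$ on all of $\mathcal M$, $W_a^{ij}\approx W_a^{ji}$, and $$[V_a,V_b]^i\approx C_{ab}^dV_d^i+D_{ab}^\alpha R_\alpha^i+J_{aj}W_b^{ji}-J_{bj}W_a^{ji}.$$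 Let $\Phi_0$ be the algebra of smooth functionals $A:\mathcal M\to\mathbb R$ having a smooth functional derivative $\delta A=A_{,i}\,\delta\varphi^i$ with values in $\Gamma_0(B^*)$ (with supports that are locally uniformly compact along smooth families). A *physical observable* is an $A\in\Phi_0$ with $R_\alpha A\approx0$. An *advanced/retarded fluctuation* caused by $A\in\Phi_0$ is a smooth vector field $V_A^\pm:\mathcal M\to\Gamma_\pm(B)$ (with supports locally uniformly in such a class) that acts on $\Phi_0$ by differentiation and satisfies $V_A^\pm T_a\approx V_aA$. The *advanced/retarded brackets* are $\{A,B\}^\pm=V_A^\pm B-V_B^\pm A$. **Proposition 4.3 (Jacobi identity).** For all physical observables $A,B,C$ and either sign, $$\{\{A,B\}^\pm,C\}^\pm+\{\{B,C\}^\pm,A\}^\pm+\{\{C,A\}^\pm,B\}^\pm\approx0,$$ whatever fluctuations are chosen to form each of the six brackets. -/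

import Mathlib

open Bundle Set Filter Topology MeasureTheory
open scoped Manifold ContDiff

noncomputable section

namespace CovariantBracket

universe u v

/-! ### Space-time, vector bundles over it, and their smooth sections -/

/-- Space-time, split by a global time function: `M = ℝ × N`, with `N` the Cauchy surface. -/
abbrev Spacetime (N : Type u) : Type u := ℝ × N

/-- The linear model of the space-time. -/
abbrev Model (d : ℕ) : Type := ℝ × EuclideanSpace ℝ (Fin d)

/-- The space of the charts of the space-time. -/
abbrev ChartModel (d : ℕ) : Type := ModelProd ℝ (EuclideanSpace ℝ (Fin d))

/-- The model with corners of the space-time (no boundary). -/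
abbrev stModel (d : ℕ) : ModelWithCorners ℝ (Model d) (ChartModel d) := 𝓘(ℝ, ℝ).prod (𝓡 d)

/-- A smooth real vector bundle of finite rank over the space-time `ℝ × N`. The norms on the fibres
only serve to present their topology. -/
structure VBundle (d : ℕ) (N : Type u) [TopologicalSpace N]
    [ChartedSpace (EuclideanSpace ℝ (Fin d)) N] where
  /-- the model fibre -/
  F : Type v
  /-- the fibres -/
  fib : Spacetime N → Type v
  [normF : NormedAddCommGroup F]
  [spaceF : NormedSpace ℝ F]
  [finF : FiniteDimensional ℝ F]
  [normFib : ∀ x, NormedAddCommGroup (fib x)]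
  [spaceFib : ∀ x, NormedSpace ℝ (fib x)]
  [top : TopologicalSpace (TotalSpace F fib)]
  [fiberBundle : FiberBundle F fib]
  [vectorBundle : VectorBundle ℝ F fib]
  [smooth : ContMDiffVectorBundle ∞ F fib (stModel d)]

attribute [instance] VBundle.normF VBundle.spaceF VBundle.finF VBundle.normFib VBundle.spaceFib
  VBundle.top VBundle.fiberBundle VBundle.vectorBundle VBundle.smooth

variable {d : ℕ} {N : Type u} [TopologicalSpace N] [ChartedSpace (EuclideanSpace ℝ (Fin d)) N]

/-- The dual bundle. -/
def VBundle.dual (E : VBundle.{u, v} d N) : VBundle.{u, v} d N where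
  F := E.F →L[ℝ] ℝ
  fib := fun x => E.fib x →L[ℝ] Bundle.Trivial (Spacetime N) ℝ x
  normFib := fun x => inferInstanceAs (NormedAddCommGroup (E.fib x →L[ℝ] ℝ))
  spaceFib := fun x => inferInstanceAs (NormedSpace ℝ (E.fib x →L[ℝ] ℝ))
  top := inferInstance
  fiberBundle := inferInstance
  vectorBundle := inferInstance
  smooth := inferInstance

/-- `Γ(E)`: the smooth sections of `E`. -/
abbrev Sec (E : VBundle.{u, v} d N) : Type (max u v) :=
  ContMDiffSection (stModel d) E.F ∞ E.fib

/-- The fibrewise pairing of a covector with a vector. -/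
def ev {E : VBundle.{u, v} d N} {x : Spacetime N} (a : E.dual.fib x) (v : E.fib x) : ℝ :=
  (show E.fib x →L[ℝ] ℝ from a) v

/-- The contraction `ζ_a ξ^a` of a section `ζ` of the dual bundle with a (not necessarily smooth)
section `ξ`, which includes the integration over the space-time. -/
def pair {E : VBundle.{u, v} d N} [MeasurableSpace N] (μ : Measure (Spacetime N))
    (ζ : Sec E.dual) (ξ : ∀ x, E.fib x) : ℝ :=
  ∫ x, ev (ζ x) (ξ x) ∂μ

/-! ### Supports -/

/-- The support of a section. -/
def supp {E : VBundle.{u, v} d N} (ξ : Sec E) : Set (Spacetime N) :=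
  closure {x | ξ x ≠ 0}

variable (N) in
/-- Compact subsets of the space-time. -/
def compactSets : Set (Set (Spacetime N)) := {K | IsCompact K}

variable (N) in
/-- Spatially compact closed sets: the part between any two instants of time is compact. -/
def spatiallyCompactSets : Set (Set (Spacetime N)) :=
  {K | IsClosed K ∧ ∀ t' t : ℝ, IsCompact (K ∩ {x | t' ≤ x.1 ∧ x.1 ≤ t})}

/-- The choice between advanced (`+`) and retarded (`-`). -/
inductive Dir
  | adv
  | ret

/-- The supports admitted in `Γ_±`: spatially compact closed sets contained in
`M_t^+ = [t, ∞) × N` (advanced) or in `M_t^- = (-∞, t] × N` (retarded) for some `t`. -/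
def Dir.sets (N : Type u) [TopologicalSpace N] : Dir → Set (Set (Spacetime N))
  | .adv => {K | K ∈ spatiallyCompactSets N ∧ ∃ t : ℝ, K ⊆ {x | t ≤ x.1}}
  | .ret => {K | K ∈ spatiallyCompactSets N ∧ ∃ t : ℝ, K ⊆ {x | x.1 ≤ t}}

/-! ### Smooth families, local sections and local operators -/

/-- `φ` is a smooth family of sections: `φ p x` is jointly smooth in the parameter `p`, which runs
over a normed space, and the point `x`. -/
def SmoothFamily {E : VBundle.{u, v} d N} {P : Type} [NormedAddCommGroup P] [NormedSpace ℝ P]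
    (φ : P → Sec E) : Prop :=
  ContMDiff (𝓘(ℝ, P).prod (stModel d)) ((stModel d).prod 𝓘(ℝ, E.F)) ∞
    (fun q : P × Spacetime N => (⟨q.2, φ q.1 q.2⟩ : TotalSpace E.F E.fib))

/-- The velocity at `s = 0` of a curve of sections. -/
def HasVelocity {E : VBundle.{u, v} d N} (φ : ℝ → Sec E) (X : Sec E) : Prop :=
  ∀ x, HasDerivAt (fun s => φ s x) (X x) 0

/-- The map `ξ` between spaces of sections is smooth: it takes finite-dimensional smooth families
to smooth families. -/
def SmoothMap {B E : VBundle.{u, v} d N} (ξ : Sec B → Sec E) : Prop :=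
  ∀ (P : Type) [NormedAddCommGroup P] [NormedSpace ℝ P] [FiniteDimensional ℝ P] (φ : P → Sec B),
    SmoothFamily φ → SmoothFamily (fun p => ξ (φ p))

/-- The map `ξ` takes values in sections with supports in the class `S`, locally uniformly along
finite-dimensional smooth families (so that derivatives of `ξ` have such supports too). -/
def SupportedIn {B E : VBundle.{u, v} d N} (S : Set (Set (Spacetime N)))
    (ξ : Sec B → Sec E) : Prop :=
  ∀ (P : Type) [NormedAddCommGroup P] [NormedSpace ℝ P] [FiniteDimensional ℝ P] (φ : P → Sec B),
    SmoothFamily φ → ∀ p, ∃ K ∈ S, ∀ᶠ q in 𝓝 p, supp (ξ (φ q)) ⊆ K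

/-- The section `s` read in the preferred chart and the preferred trivialization at `x`. -/
def localRep {E : VBundle.{u, v} d N} (s : Sec E) (x : Spacetime N) : Model d → E.F :=
  fun y => (trivializationAt E.F E.fib x
    ⟨(extChartAt (stModel d) x).symm y, s ((extChartAt (stModel d) x).symm y)⟩).2

/-- Two sections have the same `n`-jet at `x`: their partial derivatives at `x` up to the order `n`
coincide. -/
def SameJet {E : VBundle.{u, v} d N} (n : ℕ) (s t : Sec E) (x : Spacetime N) : Prop :=
  ∀ k ≤ n, iteratedFDeriv ℝ k (localRep s x) (extChartAt (stModel d) x x) =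
    iteratedFDeriv ℝ k (localRep t x) (extChartAt (stModel d) x x)

/-- `T ∈ Γ_loc(𝓔)`: `T[φ](x)` is a smooth function of `x` and of the derivatives of `φ` at `x` up
to some finite order. -/
def IsLocalSection {B E : VBundle.{u, v} d N} (T : Sec B → Sec E) : Prop :=
  (∃ n : ℕ, ∀ (φ ψ : Sec B) (x : Spacetime N), SameJet n φ ψ x → T φ x = T ψ x) ∧ SmoothMap T

/-- The linear operators `P[φ] : Γ(E) → Γ(E')` are differential operators with local coefficients:
`P[φ]a` at `x` is a smooth function of `x` and the finite jets of `φ` and `a` at `x`. -/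
def IsLocalOp {B E E' : VBundle.{u, v} d N} (P : Sec B → Sec E →ₗ[ℝ] Sec E') : Prop :=
  (∃ n : ℕ, ∀ (φ ψ : Sec B) (a b : Sec E) (x : Spacetime N),
    SameJet n φ ψ x → SameJet n a b x → P φ a x = P ψ b x) ∧
  ∀ (Q : Type) [NormedAddCommGroup Q] [NormedSpace ℝ Q] [FiniteDimensional ℝ Q]
    (φ : Q → Sec B) (a : Q → Sec E),
    SmoothFamily φ → SmoothFamily a → SmoothFamily (fun q => P (φ q) (a q))

/-- The same for bilinear operators `P[φ] : Γ(E) × Γ(E') → Γ(E'')`. -/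
def IsLocalBiop {B E E' E'' : VBundle.{u, v} d N}
    (P : Sec B → Sec E →ₗ[ℝ] Sec E' →ₗ[ℝ] Sec E'') : Prop :=
  (∃ n : ℕ, ∀ (φ ψ : Sec B) (a b : Sec E) (a' b' : Sec E') (x : Spacetime N),
    SameJet n φ ψ x → SameJet n a b x → SameJet n a' b' x → P φ a a' x = P ψ b b' x) ∧
  ∀ (Q : Type) [NormedAddCommGroup Q] [NormedSpace ℝ Q] [FiniteDimensional ℝ Q]
    (φ : Q → Sec B) (a : Q → Sec E) (a' : Q → Sec E'),
    SmoothFamily φ → SmoothFamily a → SmoothFamily a' →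
      SmoothFamily (fun q => P (φ q) (a q) (a' q))

/-! ### Functionals and vector fields on the space of fields `𝓜 = Γ(B)` -/

/-- The derivative of the functional `A` at `φ` in the direction `X`. -/
def dirDeriv {B : VBundle.{u, v} d N} (A : Sec B → ℝ) (φ X : Sec B) : ℝ :=
  deriv (fun s : ℝ => A (φ + s • X)) 0

/-- The algebra `Φ₀` of smooth compactly supported functionals: `A` is smooth along
finite-dimensional smooth families of fields, and there is a functional derivative `δA`, a smooth
section of the cotangent bundle of `𝓜` with compact support, such that `δA_i X^i` is the derivative
of `A` along any smooth curve of fields with velocity `X`. -/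
def IsFunctional {B : VBundle.{u, v} d N} [MeasurableSpace N] (μ : Measure (Spacetime N))
    (A : Sec B → ℝ) : Prop :=
  (∀ (P : Type) [NormedAddCommGroup P] [NormedSpace ℝ P] [FiniteDimensional ℝ P] (φ : P → Sec B),
    SmoothFamily φ → ContDiff ℝ ∞ (fun p => A (φ p))) ∧
  ∃ δA : Sec B → Sec B.dual, SmoothMap δA ∧ SupportedIn (compactSets N) δA ∧
    ∀ (φ : ℝ → Sec B) (X : Sec B), SmoothFamily φ → HasVelocity φ X →
      HasDerivAt (fun s => A (φ s)) (pair μ (δA (φ 0)) X) 0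

/-- `X ∈ Γ_±(T𝓜)`: a smooth vector field on `𝓜` with advanced or retarded support, which acts on
the algebra `Φ₀` by differentiation. -/
def IsVectorField {B : VBundle.{u, v} d N} [MeasurableSpace N] (μ : Measure (Spacetime N))
    (σ : Dir) (X : Sec B → Sec B) : Prop :=
  SmoothMap X ∧ SupportedIn (σ.sets N) X ∧
    ∀ A : Sec B → ℝ, IsFunctional μ A → IsFunctional μ (fun φ => dirDeriv A φ (X φ))

/-! ### Field theories with a gauge symmetry and an anchor -/

/-- The data of the theory: the bundle of fields `B`, the dynamics bundle `E`, the gauge algebra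
bundle `G`, the field equations `T[φ] = 0`, the operators `R[φ]` with the gauge symmetry generators
as kernel, and the operators `V[φ]` with the Lagrange anchor as kernel, all of them local. -/
structure FieldTheory (d : ℕ) (N : Type u) [TopologicalSpace N]
    [ChartedSpace (EuclideanSpace ℝ (Fin d)) N] where
  B : VBundle.{u, v} d N
  E : VBundle.{u, v} d N
  G : VBundle.{u, v} d N
  T : Sec B → Sec E
  R : Sec B → Sec G →ₗ[ℝ] Sec B
  V : Sec B → Sec E.dual →ₗ[ℝ] Sec B
  T_local : IsLocalSection T
  R_local : IsLocalOp R
  V_local : IsLocalOp V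

namespace FieldTheory

variable (𝒯 : FieldTheory.{u, v} d N)

/-- The dynamical shell `Σ`. -/
def shell : Set (Sec 𝒯.B) := {φ | 𝒯.T φ = 0}

/-- The Jacobi operator, `(J[φ]X)_a = T_{a,i} X^i`: the linearization of the field equations. -/
def J (φ X : Sec 𝒯.B) : ∀ x, 𝒯.E.fib x :=
  fun x => deriv (fun s : ℝ => 𝒯.T (φ + s • X) x) 0

/-- The commutator at `φ` of the vector fields `V_a` and `V_b` contracted with constant `a`, `b`:
the derivative of `V[φ]b` along `V[φ]a` minus the derivative of `V[φ]a` along `V[φ]b`. -/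
def anchorCommutator (φ : Sec 𝒯.B) (a b : Sec 𝒯.E.dual) : ∀ x, 𝒯.B.fib x :=
  fun x => deriv (fun s : ℝ => 𝒯.V (φ + s • 𝒯.V φ a) b x) 0
    - deriv (fun s : ℝ => 𝒯.V (φ + s • 𝒯.V φ b) a x) 0

/-- Regularity of the field equations: the shell is a smooth submanifold of `𝓜` whose tangent space
is the kernel of the Jacobi operator, i.e. each spatially compact solution of the linearized
equations is the velocity of a smooth curve in the shell. -/
def IsRegular : Prop :=
  ∀ φ ∈ 𝒯.shell, ∀ X : Sec 𝒯.B, supp X ∈ spatiallyCompactSets N → (∀ x, 𝒯.J φ X x = 0) →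
    ∃ γ : ℝ → Sec 𝒯.B, SmoothFamily γ ∧ (∀ s, γ s ∈ 𝒯.shell) ∧ γ 0 = φ ∧ HasVelocity γ X

/-- `R_α T_a = C_{αa}^b T_b` with local structure functions `C`. -/
def IsGaugeSymmetry : Prop :=
  ∃ C : Sec 𝒯.B → Sec 𝒯.G →ₗ[ℝ] Sec 𝒯.E →ₗ[ℝ] Sec 𝒯.E, IsLocalBiop C ∧
    ∀ (φ : Sec 𝒯.B) (ε : Sec 𝒯.G) (x), 𝒯.J φ (𝒯.R φ ε) x = C φ ε (𝒯.T φ) x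

/-- On-shell exactness of `Γ_±(G) → Γ_±(T𝓜) → Γ_±(E)`, with the maps `R` and `J`, at the middle
term (that `J ∘ R` vanishes on shell is part of `IsGaugeSymmetry`). -/
def IsExact (σ : Dir) : Prop :=
  ∀ φ ∈ 𝒯.shell, ∀ X : Sec 𝒯.B, supp X ∈ σ.sets N → (∀ x, 𝒯.J φ X x = 0) →
    ∃ ε : Sec 𝒯.G, supp ε ∈ σ.sets N ∧ X = 𝒯.R φ ε

variable [MeasurableSpace N] (μ : Measure (Spacetime N))

/-- On-shell exactness of `Γ_±(E^*) → Γ_±(T^*𝓜) → Γ_±(G^*)`, with the maps `J^*` and `R^*`, at the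
middle term. The equations `R^* η = 0` and `η = J^* ζ` for the formal adjoint operators are
expressed through arbitrary test sections with compact supports. -/
def IsDualExact (σ : Dir) : Prop :=
  ∀ φ ∈ 𝒯.shell, ∀ η : Sec 𝒯.B.dual, supp η ∈ σ.sets N →
    (∀ ε : Sec 𝒯.G, IsCompact (supp ε) → pair μ η (𝒯.R φ ε) = 0) →
    ∃ ζ : Sec 𝒯.E.dual, supp ζ ∈ σ.sets N ∧
      ∀ h : Sec 𝒯.B, IsCompact (supp h) → pair μ η h = pair μ ζ (𝒯.J φ h)

/-- `V` is a Lagrange anchor with local structure functions `C`, `D`, `W`: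
* `V_a T_b - V_b T_a = C_{ab}^d T_d` identically;
* `W_a^{ij} = W_a^{ji}` on shell;
* `[V_a, V_b]^i = C_{ab}^d V_d^i + D_{ab}^α R_α^i + J_{aj} W_b^{ji} - J_{bj} W_a^{ji}` on shell.

All free indices are contracted with test sections. -/
def IsLagrangeStructure : Prop :=
  ∃ (C : Sec 𝒯.B → Sec 𝒯.E.dual →ₗ[ℝ] Sec 𝒯.E.dual →ₗ[ℝ] Sec 𝒯.E.dual)
    (D : Sec 𝒯.B → Sec 𝒯.E.dual →ₗ[ℝ] Sec 𝒯.E.dual →ₗ[ℝ] Sec 𝒯.G)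
    (W : Sec 𝒯.B → Sec 𝒯.E.dual →ₗ[ℝ] Sec 𝒯.B.dual →ₗ[ℝ] Sec 𝒯.B),
    IsLocalBiop C ∧ IsLocalBiop D ∧ IsLocalBiop W ∧
    (∀ (φ : Sec 𝒯.B) (a b : Sec 𝒯.E.dual), IsCompact (supp a) → IsCompact (supp b) →
      pair μ b (𝒯.J φ (𝒯.V φ a)) - pair μ a (𝒯.J φ (𝒯.V φ b)) = pair μ (C φ a b) (𝒯.T φ)) ∧
    (∀ φ ∈ 𝒯.shell, ∀ (a : Sec 𝒯.E.dual) (α β : Sec 𝒯.B.dual),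
      IsCompact (supp α) → IsCompact (supp β) →
      pair μ β (W φ a α) = pair μ α (W φ a β)) ∧
    (∀ φ ∈ 𝒯.shell, ∀ (a b : Sec 𝒯.E.dual) (γ : Sec 𝒯.B.dual), IsCompact (supp γ) →
      pair μ γ (𝒯.anchorCommutator φ a b) =
        pair μ γ (𝒯.V φ (C φ a b)) + pair μ γ (𝒯.R φ (D φ a b))
          + pair μ a (𝒯.J φ (W φ b γ)) - pair μ b (𝒯.J φ (W φ a γ)))

/-- Physical observables: functionals `A ∈ Φ₀` with `A_{,i} R^i_α = 0` on shell. -/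
def IsObservable (A : Sec 𝒯.B → ℝ) : Prop :=
  IsFunctional μ A ∧
    ∀ φ ∈ 𝒯.shell, ∀ ε : Sec 𝒯.G, IsCompact (supp ε) → dirDeriv A φ (𝒯.R φ ε) = 0

/-- `X` is an advanced or retarded fluctuation `V_A^±` caused by `A`: a vector field from
`Γ_±(T𝓜)` such that `X T_a = V_a A` on shell (the index `a` is contracted with a test section). -/
def IsFluctuation (σ : Dir) (A : Sec 𝒯.B → ℝ) (X : Sec 𝒯.B → Sec 𝒯.B) : Prop :=
  IsVectorField μ σ X ∧
    ∀ φ ∈ 𝒯.shell, ∀ ζ : Sec 𝒯.E.dual, IsCompact (supp ζ) →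
      pair μ ζ (𝒯.J φ (X φ)) = dirDeriv A φ (𝒯.V φ ζ)

/-- `H` represents the bracket `{A, B}^± = V_A^± B - V_B^± A`, for some choice of the
fluctuations `V_A^±` and `V_B^±`. -/
def IsBracket (σ : Dir) (A B H : Sec 𝒯.B → ℝ) : Prop :=
  ∃ X Y : Sec 𝒯.B → Sec 𝒯.B, 𝒯.IsFluctuation μ σ A X ∧ 𝒯.IsFluctuation μ σ B Y ∧
    ∀ φ, H φ = dirDeriv B φ (X φ) - dirDeriv A φ (Y φ)

end FieldTheory

end CovariantBracket

end

/-! Fix `φ` on the shell. Dual exactness writes the derivative of each observable as `δA = J^* ζA`,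
where the multiplier `ζA` may be chosen with support of the opposite time direction to the
fluctuations. Advanced and retarded supports meet in compact sets, so multipliers pair with
fluctuations. The functional `A - ⟨ζA, T⟩` is then stationary at `φ` in the relevant directions, and
its second derivative `hess` is a symmetric form that plays the role of an invariant Hessian of `A`.

If `zC` is the value at `φ` of a fluctuation of `C`, then `V ζC - zC` lies in `Ker J` by the
compatibility of the anchor with `T`, hence is tangent to the shell by regularity. The defining
equation of fluctuations turns `{H, C}` on shell into the derivative of `H` along this tangent
vector (`dirDeriv_bracket_eq`). For `H = {A, B}` that derivative is computable, because the equation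
`⟨ζB, J X⟩ = V_{ζB} A` of a fluctuation `X` of `A` holds along the shell and can be differentiated
there: the unknown derivative of `X` drops out, leaving a Hessian term and a derivative of `V_{ζB}
A` (`eventually_dirDeriv_fluctuation`). The Hessian between a tangent and a gauge direction
vanishes, so by exactness the choice of fluctuations is immaterial (`eventually_hess_response`). The
part of the remaining derivatives along `zC`, which is not tangent to the shell, is evaluated
through `V_a T_b - V_b T_a = C_{ab}^d T_d`, an identity off shell (`eventually_anchorDir_response`).

In the cyclic sum the Hessian terms cancel by symmetry (`bracketHess_comm`). What is left is the
commutator of anchor fields contracted with multipliers (`anchorDir_sub_anchorDir`): its `V` terms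
cancel against those from the compatibility identity, its `R` terms vanish on observables, and its
`W` terms cancel in pairs by the symmetry of `W`.

Multipliers are not compactly supported, so `⟨ζ, T⟩` itself need not converge. It is replaced by
`⟨χζ, T⟩` with a cutoff `χ`, and identities are proved for all `χ` equal to `1` near a large enough
compact set. -/

noncomputable section

set_option linter.unusedSectionVars false

namespace CovariantBracket

universe u v

/-! ### Differentiation under the integral over a compact set. -/

section ParametricIntegral

variable {EM : Type*} [NormedAddCommGroup EM] [NormedSpace ℝ EM] {HM : Type*} [TopologicalSpace HM]
  {I : ModelWithCorners ℝ EM HM} {M : Type*} [TopologicalSpace M] [ChartedSpace HM M]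
  [IsManifold I 1 M]

/-- The derivative of a jointly smooth map in the parameter is jointly smooth. -/
theorem contMDiffAt_fderiv_param {P W : Type*} [NormedAddCommGroup P] [NormedSpace ℝ P]
    [NormedAddCommGroup W] [NormedSpace ℝ W] {f : P → M → W} {q : P × M}
    (hf : ContMDiffAt (𝓘(ℝ, P).prod I) 𝓘(ℝ, W) ∞ (Function.uncurry f) q) :
    ContMDiffAt (𝓘(ℝ, P).prod I) 𝓘(ℝ, P →L[ℝ] W) ∞
      (fun r : P × M => fderiv ℝ (fun p => f p r.2) r.1) q := by
  have h := ContMDiffAt.mfderiv (I := 𝓘(ℝ, P)) (I' := 𝓘(ℝ, W)) (J := 𝓘(ℝ, P).prod I)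
    (n := ∞) (m := ∞) (x₀ := q) (fun (r : P × M) (p : P) => f p r.2) Prod.fst
    (by
      have : ContMDiffAt ((𝓘(ℝ, P).prod I).prod 𝓘(ℝ, P)) (𝓘(ℝ, P).prod I) ∞
          (fun z : (P × M) × P => (z.2, z.1.2)) (q, q.1) :=
        contMDiffAt_snd.prodMk (contMDiffAt_fst.snd)
      exact ContMDiffAt.comp (q, q.1) (g := Function.uncurry f) hf this)
    contMDiffAt_fst (by simp)
  have h2 : inTangentCoordinates 𝓘(ℝ, P) 𝓘(ℝ, W) Prod.fst (fun x : P × M => f x.1 x.2)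
      (fun x => mfderiv 𝓘(ℝ, P) 𝓘(ℝ, W) (fun p => f p x.2) x.1) q =
      fun r : P × M => fderiv ℝ (fun p => f p r.2) r.1 := by
    refine (inTangentCoordinates_model_space _ _ _ _).trans ?_
    funext r
    exact mfderiv_eq_fderiv
  exact h2 ▸ h

variable [MeasurableSpace M] [BorelSpace M] [T2Space M] (μ : Measure M)
  [IsFiniteMeasureOnCompacts μ]

theorem hasFDerivAt_setIntegral_of_contMDiffOn {P W : Type*} [NormedAddCommGroup P]
    [NormedSpace ℝ P] [NormedAddCommGroup W] [NormedSpace ℝ W] {U : Set P} (hU : IsOpen U)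
    {K : Set M} (hK : IsCompact K) {f : P → M → W}
    (hf : ContMDiffOn (𝓘(ℝ, P).prod I) 𝓘(ℝ, W) ∞ (Function.uncurry f) (U ×ˢ univ))
    {p : P} (hp : p ∈ U) :
    HasFDerivAt (fun p => ∫ x in K, f p x ∂μ) (∫ x in K, fderiv ℝ (fun p => f p x) p ∂μ) p := by
  have hUo : IsOpen (U ×ˢ (univ : Set M)) := hU.prod isOpen_univ
  have hat : ∀ q ∈ U, ∀ x, ContMDiffAt (𝓘(ℝ, P).prod I) 𝓘(ℝ, W) ∞ (Function.uncurry f) (q, x) :=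
    fun q hq x => hf.contMDiffAt (hUo.mem_nhds ⟨hq, mem_univ x⟩)
  have hslice : ∀ q ∈ U, Continuous (f q) := fun q hq =>
    continuous_iff_continuousAt.2 fun x =>
      ContinuousAt.comp (g := Function.uncurry f) (f := fun x => (q, x)) (x := x)
        (hat q hq x).continuousAt (by fun_prop)
  have hdc : ∀ q ∈ U, ∀ x, ContinuousAt (fun r : P × M => fderiv ℝ (fun p => f p r.2) r.1) (q, x) :=
    fun q hq x => (contMDiffAt_fderiv_param (hat q hq x)).continuousAt
  have hdslice : Continuous (fun x => fderiv ℝ (fun p => f p x) p) :=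
    continuous_iff_continuousAt.2 fun x =>
      ContinuousAt.comp (f := fun x => (p, x)) (x := x) (hdc p hp x) (by fun_prop)
  obtain ⟨C, hC⟩ := (hK.image hdslice.norm).bddAbove
  have hC : ∀ x ∈ K, ‖fderiv ℝ (fun p => f p x) p‖ ≤ C := fun x hx => hC ⟨x, hx, rfl⟩
  -- Joint continuity of the derivative and compactness of `K` spread the bound `C` at `p` to the
  -- bound `C + 1` on a neighbourhood of `p`, uniformly over `K`.
  have hbd : ∀ᶠ q in 𝓝 p, ∀ x ∈ K, ‖fderiv ℝ (fun p => f p x) q‖ < C + 1 := by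
    refine hK.eventually_forall_of_forall_eventually fun x hx => ?_
    have := (hdc p hp x).norm.eventually_lt (continuousAt_const (y := C + 1))
      ((hC x hx).trans_lt (lt_add_one C))
    exact this
  have hs := hbd.and (hU.mem_nhds hp)
  have hKm : MeasurableSet K := hK.measurableSet
  refine hasFDerivAt_integral_of_dominated_of_fderiv_le (bound := fun _ => C + 1)
    (F' := fun q x => fderiv ℝ (fun p => f p x) q) (s := _) hs ?_ ?_ ?_ ?_ ?_ ?_
  · filter_upwards [hU.mem_nhds hp] with q hq
    exact ((hslice q hq).continuousOn).aestronglyMeasurable_of_isCompact hK hKm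
  · exact (hslice p hp).continuousOn.integrableOn_compact' hK hKm
  · exact hdslice.continuousOn.aestronglyMeasurable_of_isCompact hK hKm
  · filter_upwards [ae_restrict_mem hKm] with x hx q hq
    exact (hq.1 x hx).le
  · have : IsFiniteMeasure (μ.restrict K) := ⟨by simpa using hK.measure_lt_top⟩
    exact integrable_const _
  · refine Eventually.of_forall fun x q hq => ?_
    have h2 : ContMDiffAt 𝓘(ℝ, P) 𝓘(ℝ, W) ∞ (fun p => f p x) q :=
      ContMDiffAt.comp q (g := Function.uncurry f) (hat q hq.2 x)
        (contMDiffAt_id.prodMk contMDiffAt_const)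
    exact (h2.contDiffAt.differentiableAt (by simp)).hasFDerivAt

theorem contDiffOn_setIntegral_of_contMDiffOn {P : Type} [NormedAddCommGroup P] [NormedSpace ℝ P]
    {U : Set P} (hU : IsOpen U) {K : Set M} (hK : IsCompact K) {W : Type v}
    [NormedAddCommGroup W] [NormedSpace ℝ W] {f : P → M → W}
    (hf : ContMDiffOn (𝓘(ℝ, P).prod I) 𝓘(ℝ, W) ∞ (Function.uncurry f) (U ×ˢ univ)) :
    ContDiffOn ℝ ∞ (fun p => ∫ x in K, f p x ∂μ) U := by
  -- Each induction step replaces the values in `W` by derivatives in `P →L[ℝ] W`, so `W` has to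
  -- vary. With `P : Type` the universe of the values stays `v`.
  suffices h : ∀ (n : ℕ) (W : Type v) [NormedAddCommGroup W] [NormedSpace ℝ W] (f : P → M → W),
      ContMDiffOn (𝓘(ℝ, P).prod I) 𝓘(ℝ, W) ∞ (Function.uncurry f) (U ×ˢ univ) →
      ContDiffOn ℝ n (fun p => ∫ x in K, f p x ∂μ) U from
    contDiffOn_infty.2 fun n => h n W f hf
  intro n
  induction n with
  | zero =>
    intro W _ _ f hf
    rw [Nat.cast_zero, contDiffOn_zero]
    exact fun p hp => (hasFDerivAt_setIntegral_of_contMDiffOn μ hU hK hf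
      hp).continuousAt.continuousWithinAt
  | succ n ih =>
    intro W _ _ f hf
    rw [Nat.cast_add, Nat.cast_one, contDiffOn_succ_iff_fderiv_of_isOpen hU]
    have hd := fun p hp => hasFDerivAt_setIntegral_of_contMDiffOn μ hU hK hf (p := p) hp
    refine ⟨fun p hp => (hd p hp).differentiableAt.differentiableWithinAt, by simp, ?_⟩
    refine (ih (P →L[ℝ] W) (fun p x => fderiv ℝ (fun p => f p x) p) fun q hq => ?_).congr
      fun p hp => (hd p hp).fderiv
    exact (contMDiffAt_fderiv_param (hf.contMDiffAt
      ((hU.prod isOpen_univ).mem_nhds hq))).contMDiffWithinAt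

end ParametricIntegral

variable {d : ℕ} {N : Type u} [TopologicalSpace N] [ChartedSpace (EuclideanSpace ℝ (Fin d)) N]

/-! ### Smooth families of sections, read in local trivializations. -/

section SmoothFields

variable {E : VBundle.{u, v} d N} {P : Type} [NormedAddCommGroup P] [NormedSpace ℝ P]

/-- Joint smoothness of a family of not necessarily smooth sections. -/
def SmoothField (s : P → ∀ x, E.fib x) : Prop :=
  ContMDiff (𝓘(ℝ, P).prod (stModel d)) ((stModel d).prod 𝓘(ℝ, E.F)) ∞
    (fun q : P × Spacetime N => (⟨q.2, s q.1 q.2⟩ : TotalSpace E.F E.fib))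

/-- The trivialization of `E` at `x₀`, applied to the vector `v` at `x`. -/
def trivVal (E : VBundle.{u, v} d N) (x₀ x : Spacetime N) (w : E.fib x) : E.F :=
  (trivializationAt E.F E.fib x₀ ⟨x, w⟩).2

/-- The domain of the preferred trivialization at `x₀`. -/
def trivDom (E : VBundle.{u, v} d N) (x₀ : Spacetime N) : Set (Spacetime N) :=
  (trivializationAt E.F E.fib x₀).baseSet

theorem isOpen_trivDom (x₀ : Spacetime N) : IsOpen (trivDom E x₀) :=
  (trivializationAt E.F E.fib x₀).open_baseSet

theorem mem_trivDom (x₀ : Spacetime N) : x₀ ∈ trivDom E x₀ :=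
  FiberBundle.mem_baseSet_trivializationAt' x₀

/-- The trivialization on the fibre over a point of its domain. -/
def trivEquiv (E : VBundle.{u, v} d N) {x₀ x : Spacetime N} (hx : x ∈ trivDom E x₀) :
    E.fib x ≃L[ℝ] E.F :=
  (trivializationAt E.F E.fib x₀).continuousLinearEquivAt ℝ x hx

instance finiteDimensional_fib (x : Spacetime N) : FiniteDimensional ℝ (E.fib x) :=
  (trivEquiv E (mem_trivDom x)).toLinearEquiv.symm.finiteDimensional

theorem contMDiffAt_field_iff {Q : Type*} {EQ HQ : Type*} [NormedAddCommGroup EQ] [NormedSpace ℝ EQ]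
    [TopologicalSpace HQ] [TopologicalSpace Q] [ChartedSpace HQ Q] {IQ : ModelWithCorners ℝ EQ HQ}
    {b : Q → Spacetime N} {s : ∀ q, E.fib (b q)} {q : Q} {x₀ : Spacetime N}
    (hx : b q ∈ trivDom E x₀) :
    ContMDiffAt IQ ((stModel d).prod 𝓘(ℝ, E.F)) ∞
        (fun q => (⟨b q, s q⟩ : TotalSpace E.F E.fib)) q ↔
      ContMDiffAt IQ (stModel d) ∞ b q ∧
      ContMDiffAt IQ 𝓘(ℝ, E.F) ∞ (fun q => trivVal E x₀ (b q) (s q)) q :=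
  Bundle.Trivialization.contMDiffAt_iff (e := trivializationAt E.F E.fib x₀)
    (f := fun q => (⟨b q, s q⟩ : TotalSpace E.F E.fib))
    ((Trivialization.mem_source _).2 hx)

theorem SmoothField.contMDiffAt_trivVal {s : P → ∀ x, E.fib x} (hs : SmoothField s)
    {x₀ x : Spacetime N} (hx : x ∈ trivDom E x₀) (p : P) :
    ContMDiffAt (𝓘(ℝ, P).prod (stModel d)) 𝓘(ℝ, E.F) ∞
      (fun q : P × Spacetime N => trivVal E x₀ q.2 (s q.1 q.2)) (p, x) :=
  ((contMDiffAt_field_iff (b := Prod.snd) (s := fun q : P × Spacetime N => s q.1 q.2)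
    (q := (p, x)) hx).1 (hs (p, x))).2

theorem SmoothField.of_trivVal {s : P → ∀ x, E.fib x}
    (h : ∀ (p : P) (x : Spacetime N), ContMDiffAt (𝓘(ℝ, P).prod (stModel d)) 𝓘(ℝ, E.F) ∞
      (fun q : P × Spacetime N => trivVal E x q.2 (s q.1 q.2)) (p, x)) : SmoothField s :=
  fun q => (contMDiffAt_field_iff (b := Prod.snd) (s := fun q : P × Spacetime N => s q.1 q.2)
    (q := q) (mem_trivDom q.2)).2 ⟨contMDiffAt_snd, h q.1 q.2⟩

theorem SmoothField.contMDiff_slice {s : P → ∀ x, E.fib x} (hs : SmoothField s) (p : P) :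
    ContMDiff (stModel d) ((stModel d).prod 𝓘(ℝ, E.F)) ∞
      (fun x => (⟨x, s p x⟩ : TotalSpace E.F E.fib)) :=
  ContMDiff.comp (f := fun x : Spacetime N => (p, x)) hs (contMDiff_const.prodMk contMDiff_id)

/-- The smooth sections that form a smooth family. -/
def SmoothField.sec {s : P → ∀ x, E.fib x} (hs : SmoothField s) (p : P) : Sec E :=
  ⟨s p, hs.contMDiff_slice p⟩

theorem SmoothField.smoothFamily_sec {s : P → ∀ x, E.fib x} (hs : SmoothField s) :
    SmoothFamily hs.sec := hs

theorem SmoothFamily.smoothField {φ : P → Sec E} (h : SmoothFamily φ) :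
    SmoothField (fun p x => φ p x) := h

theorem SmoothFamily.comp {Q : Type} [NormedAddCommGroup Q] [NormedSpace ℝ Q] {φ : P → Sec E}
    (h : SmoothFamily φ) {g : Q → P} (hg : ContDiff ℝ ∞ g) : SmoothFamily (fun q => φ (g q)) :=
  ContMDiff.comp (f := fun z : Q × Spacetime N => (g z.1, z.2)) h
    ((hg.contMDiff.comp contMDiff_fst).prodMk contMDiff_snd)

theorem smoothFamily_const (φ : Sec E) : SmoothFamily (fun _ : P => φ) :=
  ContMDiff.comp (g := fun x => (⟨x, φ x⟩ : TotalSpace E.F E.fib)) φ.contMDiff contMDiff_snd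

theorem trivVal_add {x₀ x : Spacetime N} (hx : x ∈ trivDom E x₀) (v w : E.fib x) :
    trivVal E x₀ x (v + w) = trivVal E x₀ x v + trivVal E x₀ x w :=
  map_add (trivEquiv E hx) v w

theorem trivVal_smul {x₀ x : Spacetime N} (hx : x ∈ trivDom E x₀) (c : ℝ) (w : E.fib x) :
    trivVal E x₀ x (c • w) = c • trivVal E x₀ x w :=
  map_smul (trivEquiv E hx) c w

theorem eventually_mem_trivDom {Q : Type*} [TopologicalSpace Q] (p : Q) (x : Spacetime N) :
    ∀ᶠ q : Q × Spacetime N in 𝓝 (p, x), q.2 ∈ trivDom E x :=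
  continuousAt_snd.eventually ((isOpen_trivDom x).mem_nhds (mem_trivDom x))

theorem SmoothField.add {s t : P → ∀ x, E.fib x} (hs : SmoothField s) (ht : SmoothField t) :
    SmoothField (fun p x => s p x + t p x) := by
  refine .of_trivVal fun p x => ?_
  refine ((hs.contMDiffAt_trivVal (mem_trivDom x) p).add
    (ht.contMDiffAt_trivVal (mem_trivDom x) p)).congr_of_eventuallyEq ?_
  filter_upwards [eventually_mem_trivDom (E := E) p x] with q hq using trivVal_add hq _ _

theorem SmoothField.smul {s : P → ∀ x, E.fib x} (hs : SmoothField s) {f : P → Spacetime N → ℝ}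
    (hf : ContMDiff (𝓘(ℝ, P).prod (stModel d)) 𝓘(ℝ, ℝ) ∞ (Function.uncurry f)) :
    SmoothField (fun p x => f p x • s p x) := by
  refine .of_trivVal fun p x => ?_
  refine ((hf (p, x)).smul (hs.contMDiffAt_trivVal (mem_trivDom x) p)).congr_of_eventuallyEq ?_
  filter_upwards [eventually_mem_trivDom (E := E) p x] with q hq using trivVal_smul hq _ _

theorem SmoothFamily.add {φ ψ : P → Sec E} (h : SmoothFamily φ) (h' : SmoothFamily ψ) :
    SmoothFamily (fun p => φ p + ψ p) :=
  h.smoothField.add h'.smoothField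

theorem SmoothFamily.smul {φ : P → Sec E} (h : SmoothFamily φ) {f : P → ℝ} (hf : ContDiff ℝ ∞ f) :
    SmoothFamily (fun p => f p • φ p) :=
  h.smoothField.smul (f := fun p _ => f p) (hf.contMDiff.comp contMDiff_fst)

theorem SmoothField.contDiff_apply {s : P → ∀ x, E.fib x} (hs : SmoothField s) (x : Spacetime N) :
    ContDiff ℝ ∞ (fun p => s p x) := by
  have h : ContDiff ℝ ∞ (fun p => trivEquiv E (mem_trivDom x) (s p x)) := by
    rw [← contMDiff_iff_contDiff]
    exact fun p => ContMDiffAt.comp p (g := fun q : P × Spacetime N => trivVal E x q.2 (s q.1 q.2))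
      (hs.contMDiffAt_trivVal (mem_trivDom x) p) (contMDiffAt_id.prodMk contMDiffAt_const)
  have h2 : (fun p => s p x) = (trivEquiv E (mem_trivDom x)).symm ∘
      fun p => trivEquiv E (mem_trivDom x) (s p x) := by
    funext p
    simp
  exact h2 ▸ (trivEquiv E (mem_trivDom x)).symm.contDiff.comp h

theorem trivVal_fderiv {s : P → ∀ x, E.fib x} {x₀ x : Spacetime N} (hx : x ∈ trivDom E x₀)
    (p v : P) : trivVal E x₀ x (fderiv ℝ (fun p => s p x) p v) =
      fderiv ℝ (fun p => trivVal E x₀ x (s p x)) p v := by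
  have := (trivEquiv E hx).comp_fderiv (f := fun p => s p x) (x := p)
  exact (congrArg (fun l : P →L[ℝ] E.F => l v) this).symm

variable [IsManifold (𝓡 d) ∞ N]

instance isManifold_spacetime_one : IsManifold (stModel d) 1 (Spacetime N) :=
  have : IsManifold (𝓡 d) 1 N := IsManifold.of_le (n := ∞) (by simp)
  inferInstance

theorem SmoothField.fderiv_apply {s : P → ∀ x, E.fib x} (hs : SmoothField s) (v : P) :
    SmoothField (fun p x => fderiv ℝ (fun p => s p x) p v) := by
  refine .of_trivVal fun p x => ?_
  have h := contMDiffAt_fderiv_param (P := P) (W := E.F)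
    (f := fun p y => trivVal E x y (s p y)) (hs.contMDiffAt_trivVal (mem_trivDom x) p)
  refine ((ContinuousLinearMap.apply ℝ E.F v).contMDiff.contMDiffAt.comp (p, x)
    h).congr_of_eventuallyEq ?_
  filter_upwards [eventually_mem_trivDom (E := E) p x] with q hq using trivVal_fderiv hq _ _

theorem SmoothField.deriv_field {s : ℝ → ∀ x, E.fib x} (hs : SmoothField s) :
    SmoothField (fun t x => deriv (fun t => s t x) t) := hs.fderiv_apply 1

/-- Applied to the derivative of a curve, this average is the difference quotient of Hadamard's
lemma. Rescaling by `r` avoids the division by `t`, so smoothness holds across `t = 0`. -/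
theorem SmoothField.unitIntervalIntegral {s : ℝ → ∀ x, E.fib x} (hs : SmoothField s) :
    SmoothField (fun t x => ∫ r in Icc (0 : ℝ) 1, s (r * t) x) := by
  refine .of_trivVal fun t₀ x₀ => ?_
  set c := extChartAt (stModel d) x₀
  -- Parameters of the integral must run over a normed space: the point of space-time is replaced by
  -- its chart coordinate, and only `r` is integrated.
  set V : Set (ℝ × Model d) := univ ×ˢ (c.target ∩ c.symm ⁻¹' trivDom E x₀)
  have hV : IsOpen V := isOpen_univ.prod
    ((continuousOn_extChartAt_symm x₀).isOpen_inter_preimage (isOpen_extChartAt_target x₀)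
      (isOpen_trivDom x₀))
  have hf : ContMDiffOn (𝓘(ℝ, ℝ × Model d).prod 𝓘(ℝ, ℝ)) 𝓘(ℝ, E.F) ∞
      (Function.uncurry fun (q : ℝ × Model d) (r : ℝ) =>
        trivVal E x₀ (c.symm q.2) (s (r * q.1) (c.symm q.2))) (V ×ˢ univ) := by
    rintro ⟨q, r⟩ ⟨hq, -⟩
    have h1 := hs.contMDiffAt_trivVal hq.2.2 (r * q.1)
    have h2 : ContMDiffAt 𝓘(ℝ, Model d) (stModel d) ∞ c.symm q.2 :=
      (contMDiffOn_extChartAt_symm x₀).contMDiffAt ((isOpen_extChartAt_target x₀).mem_nhds hq.2.1)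
    have h3 : ContMDiffAt (𝓘(ℝ, ℝ × Model d).prod 𝓘(ℝ, ℝ)) (𝓘(ℝ, ℝ).prod (stModel d)) ∞
        (fun z : (ℝ × Model d) × ℝ => (z.2 * z.1.1, c.symm z.1.2)) (q, r) := by
      refine ContMDiffAt.prodMk ?_ ?_
      · have : ContDiff ℝ ∞ (fun q : ℝ × Model d => q.1) := contDiff_fst
        exact contMDiffAt_snd.mul (this.contMDiff.contMDiffAt.comp _ contMDiffAt_fst)
      · have : ContDiff ℝ ∞ (fun q : ℝ × Model d => q.2) := contDiff_snd
        exact ContMDiffAt.comp (x := (q, r)) (f := fun z : (ℝ × Model d) × ℝ => z.1.2) h2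
          (this.contMDiff.contMDiffAt.comp _ contMDiffAt_fst)
    exact (ContMDiffAt.comp (q, r) (g := fun z : ℝ × Spacetime N => trivVal E x₀ z.2 (s z.1 z.2))
      h1 h3).contMDiffWithinAt
  have hint := contDiffOn_setIntegral_of_contMDiffOn volume hV (isCompact_Icc (a := (0 : ℝ)) (b := 1))
    hf
  have hmem : (t₀, c x₀) ∈ V :=
    ⟨mem_univ _, mem_extChartAt_target x₀, by
      simp only [mem_preimage, c, extChartAt_to_inv]; exact mem_trivDom x₀⟩
  have h4 : ContMDiffAt (𝓘(ℝ, ℝ).prod (stModel d)) 𝓘(ℝ, ℝ × Model d) ∞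
      (fun z : ℝ × Spacetime N => (z.1, c z.2)) (t₀, x₀) :=
    contMDiffAt_fst.prodMk_space ((contMDiffAt_extChartAt (n := ∞) (I := stModel d) (x := x₀)).comp
      (t₀, x₀) contMDiffAt_snd)
  refine (ContMDiffAt.comp (t₀, x₀) (f := fun z : ℝ × Spacetime N => (z.1, c z.2))
    (hint.contDiffAt (hV.mem_nhds hmem)).contMDiffAt h4).congr_of_eventuallyEq ?_
  have hsrc : ∀ᶠ q : ℝ × Spacetime N in 𝓝 (t₀, x₀), q.2 ∈ c.source :=
    continuousAt_snd.eventually (extChartAt_source_mem_nhds x₀)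
  filter_upwards [eventually_mem_trivDom (E := E) t₀ x₀, hsrc] with q hq hqs
  simp only [Function.comp_apply]
  rw [c.left_inv hqs]
  exact ((trivEquiv E hq).integral_comp_comm _).symm

end SmoothFields

/-! ### Differential calculus for functionals that are smooth along families. -/

section Curves

variable {B E : VBundle.{u, v} d N}

/-- `F` is smooth along finite-dimensional smooth families of fields. -/
def SmoothFunctional (F : Sec B → ℝ) : Prop :=
  ∀ (P : Type) [NormedAddCommGroup P] [NormedSpace ℝ P] [FiniteDimensional ℝ P] (φ : P → Sec B),
    SmoothFamily φ → ContDiff ℝ ∞ (fun p => F (φ p))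

theorem sec_zero_smul (X : Sec E) : (0 : ℝ) • X = 0 := zero_smul ℝ X

theorem sec_smul_zero (t : ℝ) : t • (0 : Sec E) = 0 := by
  ext x
  exact smul_zero t

theorem smoothFamily_line (φ X : Sec B) : SmoothFamily (fun s : ℝ => φ + s • X) :=
  (smoothFamily_const φ).add ((smoothFamily_const X).smul contDiff_id)

theorem hasVelocity_line (φ X : Sec B) : HasVelocity (fun s : ℝ => φ + s • X) X := by
  intro x
  have h : HasDerivAt (fun s : ℝ => φ x + s • X x) ((1 : ℝ) • X x) 0 :=
    ((hasDerivAt_id (0 : ℝ)).smul_const (X x)).const_add (φ x)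
  simpa using h

theorem smoothMap_const (X : Sec E) : SmoothMap (fun _ : Sec B => X) :=
  fun _ _ _ _ _ _ => smoothFamily_const X

theorem SmoothFunctional.sub {F G : Sec B → ℝ} (hF : SmoothFunctional F)
    (hG : SmoothFunctional G) : SmoothFunctional (fun ψ => F ψ - G ψ) :=
  fun P _ _ _ φ hφ => (hF P φ hφ).sub (hG P φ hφ)

theorem smoothFamily_plane (φ X Y : Sec B) :
    SmoothFamily (fun q : ℝ × ℝ => φ + q.1 • X + q.2 • Y) :=
  ((smoothFamily_const φ).add ((smoothFamily_const X).smul contDiff_fst)).add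
    ((smoothFamily_const Y).smul contDiff_snd)

theorem SmoothMap.line {X : Sec B → Sec E} (hX : SmoothMap X) (φ Y : Sec B) :
    SmoothFamily (fun s : ℝ => X (φ + s • Y)) := hX ℝ _ (smoothFamily_line φ Y)

variable [IsManifold (𝓡 d) ∞ N]

/-- The velocity at `s = 0` of a smooth curve of sections. -/
def SmoothFamily.velocity {c : ℝ → Sec E} (hc : SmoothFamily c) : Sec E :=
  hc.smoothField.deriv_field.sec 0

theorem SmoothFamily.hasVelocity {c : ℝ → Sec E} (hc : SmoothFamily c) :
    HasVelocity c hc.velocity := fun x =>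
  ((hc.smoothField.contDiff_apply x).differentiable (by simp) 0).hasDerivAt

/-- Hadamard's lemma for smooth curves of sections. -/
theorem SmoothFamily.exists_eq_add_smul {c : ℝ → Sec E} (hc : SmoothFamily c) :
    ∃ g : ℝ → Sec E, SmoothFamily g ∧ (∀ t, c t = c 0 + t • g t) ∧
      ∀ X, HasVelocity c X → g 0 = X := by
  have hs := hc.smoothField.deriv_field.unitIntervalIntegral
  refine ⟨hs.sec, hs.smoothFamily_sec, fun t => ?_, fun X hX => ?_⟩
  · ext x
    have : CompleteSpace (E.fib x) := FiniteDimensional.complete ℝ _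
    have hd := hc.smoothField.contDiff_apply x
    have hder : Continuous (deriv fun t => c t x) := hd.continuous_deriv (by simp)
    have h := intervalIntegral.integral_unitInterval_deriv_eq_sub (𝕜 := ℝ) (f := fun t => c t x)
      (f' := deriv fun t => c t x) (z₀ := 0) (z₁ := t) (by fun_prop)
      (fun r _ => (hd.differentiable (by simp) _).hasDerivAt)
    rw [intervalIntegral.integral_of_le zero_le_one, ← integral_Icc_eq_integral_Ioc] at h
    simp only [zero_add, smul_eq_mul] at h
    change c t x = c 0 x + t • ∫ r in Icc (0 : ℝ) 1, deriv (fun t => c t x) (r * t)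
    rw [h]
    abel
  · ext x
    change ∫ r in Icc (0 : ℝ) 1, deriv (fun t => c t x) (r * 0) = X x
    have : CompleteSpace (E.fib x) := FiniteDimensional.complete ℝ _
    simp [(hX x).deriv]

/-- The chain rule for smooth functionals along smooth curves of fields. -/
theorem SmoothFunctional.hasDerivAt {F : Sec B → ℝ} (hF : SmoothFunctional F) {c : ℝ → Sec B}
    (hc : SmoothFamily c) {X : Sec B} (hX : HasVelocity c X) :
    HasDerivAt (fun t => F (c t)) (dirDeriv F (c 0) X) 0 := by
  obtain ⟨g, hg, hcg, hgX⟩ := hc.exists_eq_add_smul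
  -- By Hadamard's lemma the curve is the diagonal of this two-parameter family. The family is
  -- constant on `q.1 = 0` and is the straight line along `g 0` on `q.2 = 0`, so only the latter
  -- contributes to the derivative.
  have hΦ : SmoothFamily (fun q : ℝ × ℝ => c 0 + q.1 • g q.2) :=
    (smoothFamily_const _).add ((hg.comp contDiff_snd).smul contDiff_fst)
  have hd : DifferentiableAt ℝ (fun q : ℝ × ℝ => F (c 0 + q.1 • g q.2)) (0, 0) :=
    (hF _ _ hΦ).differentiable (by simp) _
  have h1 : HasDerivAt (fun t : ℝ => F (c 0 + t • g 0)) _ 0 :=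
    hd.hasFDerivAt.comp_hasDerivAt (f := fun t : ℝ => (t, (0 : ℝ))) 0
      ((hasDerivAt_id _).prodMk (hasDerivAt_const _ _))
  have h2 : HasDerivAt (fun t : ℝ => F (c 0 + (0 : ℝ) • g t)) _ 0 :=
    hd.hasFDerivAt.comp_hasDerivAt (f := fun t : ℝ => ((0 : ℝ), t)) 0
      ((hasDerivAt_const _ _).prodMk (hasDerivAt_id _))
  have h3 : HasDerivAt (fun t : ℝ => F (c 0 + t • g t)) _ 0 :=
    hd.hasFDerivAt.comp_hasDerivAt (f := fun t : ℝ => (t, t)) 0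
      ((hasDerivAt_id _).prodMk (hasDerivAt_id _))
  simp only [sec_zero_smul] at h2
  have h20 := h2.unique (hasDerivAt_const (0 : ℝ) (F (c 0 + 0)))
  have hdir : dirDeriv F (c 0) (g 0) = _ := h1.deriv
  rw [← hgX X hX, hdir]
  have hsum : ((1 : ℝ), (1 : ℝ)) = (1, 0) + (0, 1) := by simp
  rw [hsum, map_add, h20, add_zero] at h3
  simpa only [← hcg] using h3

section

variable {P : Type} [NormedAddCommGroup P] [NormedSpace ℝ P] [FiniteDimensional ℝ P]

/-- Passing to Fréchet derivatives in finite dimensions gives `dirDeriv` the linearity, smoothness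
and symmetry that are not visible in its definition line by line. -/
theorem SmoothFunctional.fderiv_family {F : Sec B → ℝ} (hF : SmoothFunctional F) {Φ : P → Sec B}
    (hΦ : SmoothFamily Φ) {p v : P} {X : Sec B} (hX : HasVelocity (fun t : ℝ => Φ (p + t • v)) X) :
    fderiv ℝ (fun p => F (Φ p)) p v = dirDeriv F (Φ p) X := by
  have hc : SmoothFamily (fun t : ℝ => Φ (p + t • v)) :=
    hΦ.comp (contDiff_const.add (contDiff_id.smul contDiff_const))
  have h := hF.hasDerivAt hc hX
  have hd : HasFDerivAt (fun p => F (Φ p)) (fderiv ℝ (fun p => F (Φ p)) p) p :=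
    ((hF _ _ hΦ).differentiable (by simp) p).hasFDerivAt
  have h' := hd.hasLineDerivAt v |>.lineDeriv
  simp only [zero_smul, add_zero] at h
  rw [← h', ← h.deriv]
  rfl

theorem SmoothFunctional.contDiff_dirDeriv {F : Sec B → ℝ} (hF : SmoothFunctional F)
    {φ X : P → Sec B} (hφ : SmoothFamily φ) (hX : SmoothFamily X) :
    ContDiff ℝ ∞ (fun p => dirDeriv F (φ p) (X p)) := by
  have hΨ : SmoothFamily (fun q : P × ℝ => φ q.1 + q.2 • X q.1) :=
    (hφ.comp contDiff_fst).add ((hX.comp contDiff_fst).smul contDiff_snd)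
  have h := hF _ _ hΨ
  have h2 : (fun p => dirDeriv F (φ p) (X p)) =
      fun p => fderiv ℝ (fun q : P × ℝ => F (φ q.1 + q.2 • X q.1)) (p, 0) (0, 1) := by
    funext p
    have hv : HasVelocity (fun t : ℝ => (fun q : P × ℝ => φ q.1 + q.2 • X q.1)
        ((p, (0 : ℝ)) + t • ((0 : P), (1 : ℝ)))) (X p) := by
      simpa [sec_zero_smul] using hasVelocity_line (φ p) (X p)
    simpa [sec_zero_smul] using (hF.fderiv_family hΨ hv).symm
  rw [h2]
  have h3 : ContDiff ℝ ∞ (fderiv ℝ (fun q : P × ℝ => F (φ q.1 + q.2 • X q.1))) :=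
    h.fderiv_right (by simp)
  exact (h3.comp (contDiff_id.prodMk contDiff_const)).clm_apply contDiff_const

end

theorem SmoothFunctional.dirDeriv_along {F : Sec B → ℝ} (hF : SmoothFunctional F)
    {X : Sec B → Sec B} (hX : SmoothMap X) : SmoothFunctional (fun ψ => dirDeriv F ψ (X ψ)) :=
  fun P _ _ _ φ hφ => hF.contDiff_dirDeriv hφ (hX P φ hφ)

theorem SmoothFunctional.dirDeriv_const {F : Sec B → ℝ} (hF : SmoothFunctional F) (W : Sec B) :
    SmoothFunctional (fun ψ => dirDeriv F ψ W) := hF.dirDeriv_along (smoothMap_const W)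

theorem SmoothFunctional.dirDeriv_fixed {F : Sec B → ℝ} (hF : SmoothFunctional F) (φ : Sec B) :
    SmoothFunctional (fun ψ => dirDeriv F φ ψ) :=
  fun _ _ _ _ _ hφ => hF.contDiff_dirDeriv (smoothFamily_const φ) hφ

theorem SmoothFunctional.hasDerivAt_line {F : Sec B → ℝ} (hF : SmoothFunctional F) (φ X : Sec B) :
    HasDerivAt (fun s : ℝ => F (φ + s • X)) (dirDeriv F φ X) 0 := by
  simpa [sec_zero_smul] using hF.hasDerivAt (smoothFamily_line φ X) (hasVelocity_line φ X)

theorem dirDeriv_sub_functional {F G : Sec B → ℝ} (hF : SmoothFunctional F)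
    (hG : SmoothFunctional G) (φ X : Sec B) :
    dirDeriv (fun ψ => F ψ - G ψ) φ X = dirDeriv F φ X - dirDeriv G φ X :=
  ((hF.hasDerivAt_line φ X).sub (hG.hasDerivAt_line φ X)).deriv

theorem SmoothFunctional.fderiv_plane {F : Sec B → ℝ} (hF : SmoothFunctional F) (φ X Y : Sec B)
    (p v : ℝ × ℝ) : fderiv ℝ (fun q : ℝ × ℝ => F (φ + q.1 • X + q.2 • Y)) p v =
      dirDeriv F (φ + p.1 • X + p.2 • Y) (v.1 • X + v.2 • Y) := by
  refine hF.fderiv_family (smoothFamily_plane φ X Y) ?_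
  convert! hasVelocity_line (φ + p.1 • X + p.2 • Y) (v.1 • X + v.2 • Y) using 2 with t
  simp only [Prod.fst_add, Prod.snd_add, Prod.smul_fst, Prod.smul_snd, smul_eq_mul]
  module

theorem SmoothFunctional.dirDeriv_add {F : Sec B → ℝ} (hF : SmoothFunctional F) (φ X Y : Sec B) :
    dirDeriv F φ (X + Y) = dirDeriv F φ X + dirDeriv F φ Y := by
  have h := hF.fderiv_plane φ X Y (0, 0)
  have h1 := h (1, 1)
  have h2 := h (1, 0)
  have h3 := h (0, 1)
  simp only [sec_zero_smul, one_smul, add_zero, zero_add] at h1 h2 h3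
  rw [← h1, ← h2, ← h3, ← map_add]
  simp

theorem SmoothFunctional.dirDeriv_smul {F : Sec B → ℝ} (hF : SmoothFunctional F) (φ X : Sec B)
    (t : ℝ) : dirDeriv F φ (t • X) = t * dirDeriv F φ X := by
  have h := hF.fderiv_plane φ X 0 (0, 0)
  have h1 := h (t, 0)
  have h2 := h (1, 0)
  simp only [sec_zero_smul, one_smul, add_zero, sec_smul_zero] at h1 h2
  rw [← h1, ← h2, ← smul_eq_mul, ← map_smul]
  simp

theorem SmoothFunctional.dirDeriv_sub {F : Sec B → ℝ} (hF : SmoothFunctional F) (φ X Y : Sec B) :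
    dirDeriv F φ (X - Y) = dirDeriv F φ X - dirDeriv F φ Y := by
  have h := hF.dirDeriv_add φ (X - Y) Y
  rw [sub_add_cancel] at h
  linarith

/-- The second derivative of a functional. -/
def dirDeriv₂ (F : Sec B → ℝ) (φ X Y : Sec B) : ℝ := dirDeriv (fun ψ => dirDeriv F ψ Y) φ X

theorem SmoothFunctional.dirDeriv₂_sub_left {F : Sec B → ℝ} (hF : SmoothFunctional F)
    (φ X X' Y : Sec B) : dirDeriv₂ F φ (X - X') Y = dirDeriv₂ F φ X Y - dirDeriv₂ F φ X' Y :=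
  (hF.dirDeriv_const Y).dirDeriv_sub φ X X'

/-- Symmetry of second derivatives on the plane through `φ` spanned by `X` and `Y`. -/
theorem SmoothFunctional.dirDeriv₂_comm {F : Sec B → ℝ} (hF : SmoothFunctional F)
    (φ X Y : Sec B) : dirDeriv₂ F φ X Y = dirDeriv₂ F φ Y X := by
  have hc := hF _ _ (smoothFamily_plane φ X Y)
  have hsymm := (hc.contDiffAt (x := (0, 0))).isSymmSndFDerivAt (minSmoothness_of_isRCLikeNormedField.trans_le
    (show ((2 : ℕ∞) : WithTop ℕ∞) ≤ ∞ from WithTop.coe_le_coe.2 le_top))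
  have hd : Differentiable ℝ (fderiv ℝ (fun q : ℝ × ℝ => F (φ + q.1 • X + q.2 • Y))) :=
    (hc.fderiv_right (m := ∞) (by simp)).differentiable (by simp)
  have key : ∀ v w : ℝ × ℝ,
      fderiv ℝ (fderiv ℝ (fun q : ℝ × ℝ => F (φ + q.1 • X + q.2 • Y))) (0, 0) v w =
        dirDeriv₂ F φ (v.1 • X + v.2 • Y) (w.1 • X + w.2 • Y) := by
    intro v w
    have h1 := (hF.dirDeriv_const (w.1 • X + w.2 • Y)).fderiv_plane φ X Y (0, 0) v
    simp only [← hF.fderiv_plane φ X Y _ w] at h1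
    simp only [sec_zero_smul, add_zero] at h1
    rw [dirDeriv₂, ← h1, fderiv_clm_apply (hd _) (differentiableAt_const _)]
    simp
  have h := hsymm (1, 0) (0, 1)
  rw [key, key] at h
  simpa [sec_zero_smul] using h

/-- The derivative of a smooth map `X : Γ(B) → Γ(E)` at `φ` along `Y`. -/
def SmoothMap.dir {X : Sec B → Sec E} (hX : SmoothMap X) (φ Y : Sec B) : Sec E :=
  (hX.line φ Y).velocity

/-- The Leibniz rule for the derivative of `ψ ↦ F_{,i}[ψ] X^i[ψ]`. -/
theorem SmoothFunctional.dirDeriv_dirDeriv {F : Sec B → ℝ} (hF : SmoothFunctional F)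
    {X : Sec B → Sec B} (hX : SmoothMap X) (φ Y : Sec B) :
    dirDeriv (fun ψ => dirDeriv F ψ (X ψ)) φ Y =
      dirDeriv₂ F φ Y (X φ) + dirDeriv F φ (hX.dir φ Y) := by
  -- The two places where the field occurs get independent parameters; the derivative along the
  -- diagonal is the sum of the partial ones.
  have hc : ContDiff ℝ ∞ (fun q : ℝ × ℝ => dirDeriv F (φ + q.1 • Y) (X (φ + q.2 • Y))) :=
    hF.contDiff_dirDeriv ((smoothFamily_line φ Y).comp contDiff_fst)
      ((hX.line φ Y).comp contDiff_snd)
  have hd := (hc.differentiable (by simp) (0, 0)).hasFDerivAt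
  have h1 : HasDerivAt (fun t : ℝ => dirDeriv F (φ + t • Y) (X (φ + (0 : ℝ) • Y))) _ 0 :=
    hd.comp_hasDerivAt (f := fun t : ℝ => (t, (0 : ℝ))) 0
      ((hasDerivAt_id _).prodMk (hasDerivAt_const _ _))
  have h2 : HasDerivAt (fun t : ℝ => dirDeriv F (φ + (0 : ℝ) • Y) (X (φ + t • Y))) _ 0 :=
    hd.comp_hasDerivAt (f := fun t : ℝ => ((0 : ℝ), t)) 0
      ((hasDerivAt_const _ _).prodMk (hasDerivAt_id _))
  have h3 : HasDerivAt (fun t : ℝ => dirDeriv F (φ + t • Y) (X (φ + t • Y))) _ 0 :=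
    hd.comp_hasDerivAt (f := fun t : ℝ => (t, t)) 0
      ((hasDerivAt_id _).prodMk (hasDerivAt_id _))
  simp only [sec_zero_smul, add_zero] at h1 h2
  have h4 := (hF.dirDeriv_fixed φ).hasDerivAt (hX.line φ Y) (hX.line φ Y).hasVelocity
  -- At a fixed field the derivative of `F` is linear in the direction, hence is its own derivative.
  have h5 : dirDeriv (fun ψ => dirDeriv F φ ψ) (X (φ + (0 : ℝ) • Y)) (hX.dir φ Y) =
      dirDeriv F φ (hX.dir φ Y) := by
    refine HasDerivAt.deriv (𝕜 := ℝ) ?_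
    simp only [hF.dirDeriv_add, hF.dirDeriv_smul]
    simpa using ((hasDerivAt_id (0 : ℝ)).mul_const (dirDeriv F φ (hX.dir φ Y))).const_add
      (dirDeriv F φ (X (φ + (0 : ℝ) • Y)))
  have h6 := h2.unique h4
  have h7 : dirDeriv₂ F φ Y (X φ) = _ := h1.deriv
  refine h3.deriv.trans ?_
  have hsum : ((1 : ℝ), (1 : ℝ)) = (1, 0) + (0, 1) := by simp
  rw [hsum, map_add, ← h7, h6]
  exact congrArg _ h5

end Curves

/-! ### Local operators and their supports. -/

section Locality

variable {B E E' E'' : VBundle.{u, v} d N}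

theorem eq_zero_of_notMem_supp {s : Sec E} {x : Spacetime N} (h : x ∉ supp s) : s x = 0 := by
  by_contra h0
  exact h (subset_closure h0)

theorem eventually_eq_zero_of_notMem_supp {s : Sec E} {x : Spacetime N} (h : x ∉ supp s) :
    ∀ᶠ y in 𝓝 x, s y = 0 := by
  filter_upwards [isClosed_closure.isOpen_compl.mem_nhds h] with y hy
    using eq_zero_of_notMem_supp hy

theorem supp_subset {s : Sec E} {K : Set (Spacetime N)} (hK : IsClosed K)
    (h : ∀ x ∉ K, s x = 0) : supp s ⊆ K :=
  closure_minimal (fun x hx => by_contra fun hxK => hx (h x hxK)) hK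

theorem isClosed_supp (s : Sec E) : IsClosed (supp s) := isClosed_closure

theorem supp_sub_subset (s t : Sec E) : supp (s - t) ⊆ supp s ∪ supp t :=
  supp_subset ((isClosed_supp s).union (isClosed_supp t)) fun x hx => by
    rw [mem_union, not_or] at hx
    change s x - t x = 0
    rw [eq_zero_of_notMem_supp hx.1, eq_zero_of_notMem_supp hx.2, sub_zero]

/-- Dependence on finite jets enters the argument only through this consequence, dependence on
germs. -/
theorem sameJet_of_eventually_eq {s t : Sec E} {x : Spacetime N} (h : ∀ᶠ y in 𝓝 x, s y = t y)
    (n : ℕ) : SameJet n s t x := by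
  intro k _
  have hc : ContinuousAt (extChartAt (stModel d) x).symm (extChartAt (stModel d) x x) :=
    continuousAt_extChartAt_symm x
  have h' : ∀ᶠ y in 𝓝 (extChartAt (stModel d) x x),
      s ((extChartAt (stModel d) x).symm y) = t ((extChartAt (stModel d) x).symm y) := by
    refine hc.eventually (p := fun z => s z = t z) ?_
    rwa [extChartAt_to_inv]
  have h'' : localRep s x =ᶠ[𝓝 (extChartAt (stModel d) x x)] localRep t x := by
    filter_upwards [h'] with y hy
    simp only [localRep, hy]
  exact Filter.EventuallyEq.eq_of_nhds (Filter.EventuallyEq.iteratedFDeriv ℝ h'' k)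

theorem IsLocalSection.congr {T : Sec B → Sec E} (hT : IsLocalSection T) {φ ψ : Sec B}
    {x : Spacetime N} (h : ∀ᶠ y in 𝓝 x, φ y = ψ y) : T φ x = T ψ x :=
  hT.1.elim fun n hn => hn φ ψ x (sameJet_of_eventually_eq h n)

theorem IsLocalOp.congr {P : Sec B → Sec E →ₗ[ℝ] Sec E'} (hP : IsLocalOp P) {φ ψ : Sec B}
    {a b : Sec E} {x : Spacetime N} (h : ∀ᶠ y in 𝓝 x, φ y = ψ y) (h' : ∀ᶠ y in 𝓝 x, a y = b y) :
    P φ a x = P ψ b x :=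
  hP.1.elim fun n hn => hn φ ψ a b x (sameJet_of_eventually_eq h n) (sameJet_of_eventually_eq h' n)

theorem IsLocalOp.congr_right {P : Sec B → Sec E →ₗ[ℝ] Sec E'} (hP : IsLocalOp P) (φ : Sec B)
    {a b : Sec E} {x : Spacetime N} (h' : ∀ᶠ y in 𝓝 x, a y = b y) : P φ a x = P φ b x :=
  hP.congr (.of_forall fun _ => rfl) h'

theorem IsLocalBiop.congr {P : Sec B → Sec E →ₗ[ℝ] Sec E' →ₗ[ℝ] Sec E''} (hP : IsLocalBiop P)
    (φ : Sec B) {a b : Sec E} {a' b' : Sec E'} {x : Spacetime N}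
    (h : ∀ᶠ y in 𝓝 x, a y = b y) (h' : ∀ᶠ y in 𝓝 x, a' y = b' y) : P φ a a' x = P φ b b' x :=
  hP.1.elim fun n hn => hn φ φ a b a' b' x (sameJet_of_eventually_eq (.of_forall fun _ => rfl) n)
    (sameJet_of_eventually_eq h n) (sameJet_of_eventually_eq h' n)

theorem IsLocalOp.supp_subset {P : Sec B → Sec E →ₗ[ℝ] Sec E'} (hP : IsLocalOp P) (φ : Sec B)
    (a : Sec E) : supp (P φ a) ⊆ supp a :=
  CovariantBracket.supp_subset (isClosed_supp a) fun x hx => by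
    rw [hP.congr_right φ (b := 0) (eventually_eq_zero_of_notMem_supp hx), map_zero]
    rfl

theorem IsLocalBiop.supp_subset_left {P : Sec B → Sec E →ₗ[ℝ] Sec E' →ₗ[ℝ] Sec E''}
    (hP : IsLocalBiop P) (φ : Sec B) (a : Sec E) (b : Sec E') : supp (P φ a b) ⊆ supp a :=
  supp_subset (isClosed_supp a) fun x hx => by
    rw [hP.congr φ (b := 0) (b' := b) (eventually_eq_zero_of_notMem_supp hx)
      (.of_forall fun _ => rfl), map_zero]
    rfl

theorem IsLocalBiop.supp_subset_right {P : Sec B → Sec E →ₗ[ℝ] Sec E' →ₗ[ℝ] Sec E''}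
    (hP : IsLocalBiop P) (φ : Sec B) (a : Sec E) (b : Sec E') : supp (P φ a b) ⊆ supp b :=
  supp_subset (isClosed_supp b) fun x hx => by
    rw [hP.congr φ (b := a) (b' := 0) (.of_forall fun _ => rfl)
      (eventually_eq_zero_of_notMem_supp hx), map_zero]
    rfl

theorem IsLocalOp.smoothMap {P : Sec B → Sec E →ₗ[ℝ] Sec E'} (hP : IsLocalOp P) (a : Sec E) :
    SmoothMap (fun φ => P φ a) :=
  fun Q _ _ _ φ hφ => hP.2 Q φ (fun _ => a) hφ (smoothFamily_const a)

theorem eventually_line_eq (φ : Sec B) {W W' : Sec B} {x : Spacetime N}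
    (h : ∀ᶠ y in 𝓝 x, W y = W' y) (s : ℝ) : ∀ᶠ y in 𝓝 x, (φ + s • W) y = (φ + s • W') y := by
  filter_upwards [h] with y hy
  change φ y + s • W y = φ y + s • W' y
  rw [hy]

variable [IsManifold (𝓡 d) ∞ N]

theorem SmoothMap.dir_apply {X : Sec B → Sec E} (hX : SmoothMap X) (φ Y : Sec B)
    (x : Spacetime N) : hX.dir φ Y x = deriv (fun s : ℝ => X (φ + s • Y) x) 0 := rfl

theorem IsLocalSection.dir_congr {T : Sec B → Sec E} (hT : IsLocalSection T) (φ : Sec B)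
    {W W' : Sec B} {x : Spacetime N} (h : ∀ᶠ y in 𝓝 x, W y = W' y) :
    hT.2.dir φ W x = hT.2.dir φ W' x := by
  simp only [SmoothMap.dir_apply, hT.congr (eventually_line_eq φ h _)]

theorem IsLocalSection.dir_supp_subset {T : Sec B → Sec E} (hT : IsLocalSection T) (φ W : Sec B) :
    supp (hT.2.dir φ W) ⊆ supp W :=
  supp_subset (isClosed_supp W) fun x hx => by
    rw [hT.dir_congr φ (W' := 0) (eventually_eq_zero_of_notMem_supp hx)]
    simp [SmoothMap.dir_apply, sec_smul_zero]

theorem IsLocalOp.dir_supp_subset {P : Sec B → Sec E →ₗ[ℝ] Sec E'} (hP : IsLocalOp P)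
    (a : Sec E) (φ Y : Sec B) : supp ((hP.smoothMap a).dir φ Y) ⊆ supp a :=
  CovariantBracket.supp_subset (isClosed_supp a) fun x hx => by
    rw [SmoothMap.dir_apply]
    have h : ∀ s : ℝ, P (φ + s • Y) a x = 0 := fun s =>
      eq_zero_of_notMem_supp fun h => hx (hP.supp_subset _ a h)
    simp [h]

/-- Outside `supp Y` the fields `φ + s • Y` do not move with `s`, so neither do the coefficients of
the operator. -/
theorem IsLocalOp.dir_supp_subset_dir {P : Sec B → Sec E →ₗ[ℝ] Sec E'} (hP : IsLocalOp P)
    (a : Sec E) (φ Y : Sec B) : supp ((hP.smoothMap a).dir φ Y) ⊆ supp Y :=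
  CovariantBracket.supp_subset (isClosed_supp Y) fun x hx => by
    rw [SmoothMap.dir_apply]
    have h : ∀ s : ℝ, P (φ + s • Y) a x = P (φ + s • (0 : Sec B)) a x := fun s =>
      hP.congr (eventually_line_eq φ (eventually_eq_zero_of_notMem_supp hx) s)
        (.of_forall fun _ => rfl)
    simp [h, sec_smul_zero]

theorem SupportedIn.exists_dir {S : Set (Set (Spacetime N))} (hS : ∀ K ∈ S, IsClosed K)
    {X : Sec B → Sec E} (hX : SmoothMap X) (hXS : SupportedIn S X) (φ Y : Sec B) :
    ∃ K ∈ S, supp (hX.dir φ Y) ⊆ K := by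
  obtain ⟨K, hK, h⟩ := hXS ℝ _ (smoothFamily_line φ Y) 0
  refine ⟨K, hK, supp_subset (hS K hK) fun x hx => ?_⟩
  have h0 : (fun s : ℝ => X (φ + s • Y) x) =ᶠ[𝓝 0] fun _ => 0 := by
    filter_upwards [h] with s hs using eq_zero_of_notMem_supp fun hxs => hx (hs hxs)
  rw [SmoothMap.dir_apply, h0.deriv_eq]
  simp

end Locality

/-! ### Advanced and retarded supports. -/

section Supports

variable {B E : VBundle.{u, v} d N}

/-- The opposite choice between advanced and retarded. -/
def Dir.op : Dir → Dir
  | .adv => .ret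
  | .ret => .adv

theorem Dir.spatiallyCompact {σ : Dir} {K : Set (Spacetime N)} (h : K ∈ σ.sets N) :
    K ∈ spatiallyCompactSets N := by
  cases σ <;> exact h.1

theorem Dir.isClosed {σ : Dir} {K : Set (Spacetime N)} (h : K ∈ σ.sets N) : IsClosed K :=
  (Dir.spatiallyCompact h).1

theorem spatiallyCompactSets.mono {K L : Set (Spacetime N)} (h : K ∈ spatiallyCompactSets N)
    (hL : IsClosed L) (hLK : L ⊆ K) : L ∈ spatiallyCompactSets N := by
  refine ⟨hL, fun t' t => ?_⟩
  have : L ∩ {x | t' ≤ x.1 ∧ x.1 ≤ t} = (K ∩ {x | t' ≤ x.1 ∧ x.1 ≤ t}) ∩ L := by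
    ext x
    simp only [mem_inter_iff]
    exact ⟨fun h => ⟨⟨hLK h.1, h.2⟩, h.1⟩, fun h => ⟨h.2, h.1.2⟩⟩
  rw [this]
  exact (h.2 t' t).inter_right hL

theorem spatiallyCompactSets.union {K L : Set (Spacetime N)} (hK : K ∈ spatiallyCompactSets N)
    (hL : L ∈ spatiallyCompactSets N) : K ∪ L ∈ spatiallyCompactSets N := by
  refine ⟨hK.1.union hL.1, fun t' t => ?_⟩
  rw [union_inter_distrib_right]
  exact (hK.2 t' t).union (hL.2 t' t)

theorem Dir.sets_mono {σ : Dir} {K L : Set (Spacetime N)} (h : K ∈ σ.sets N) (hL : IsClosed L)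
    (hLK : L ⊆ K) : L ∈ σ.sets N := by
  cases σ with
  | adv =>
    obtain ⟨h, t, ht⟩ := h
    exact ⟨spatiallyCompactSets.mono h hL hLK, t, hLK.trans ht⟩
  | ret =>
    obtain ⟨h, t, ht⟩ := h
    exact ⟨spatiallyCompactSets.mono h hL hLK, t, hLK.trans ht⟩

theorem Dir.sets_union {σ : Dir} {K L : Set (Spacetime N)} (hK : K ∈ σ.sets N)
    (hL : L ∈ σ.sets N) : K ∪ L ∈ σ.sets N := by
  cases σ with
  | adv =>
    obtain ⟨hK, t, ht⟩ := hK
    obtain ⟨hL, s, hs⟩ := hL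
    refine ⟨spatiallyCompactSets.union hK hL, min t s, union_subset (ht.trans fun x hx => ?_) (hs.trans fun x hx => ?_)⟩
    · exact (min_le_left t s).trans (show _ ≤ x.1 from hx)
    · exact (min_le_right t s).trans (show _ ≤ x.1 from hx)
  | ret =>
    obtain ⟨hK, t, ht⟩ := hK
    obtain ⟨hL, s, hs⟩ := hL
    refine ⟨spatiallyCompactSets.union hK hL, max t s, union_subset (ht.trans fun x hx => ?_) (hs.trans fun x hx => ?_)⟩
    · exact le_trans (show x.1 ≤ _ from hx) (le_max_left t s)
    · exact le_trans (show x.1 ≤ _ from hx) (le_max_right t s)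

/-- One set bounds the time from below and the other from above, so spatial compactness applies.
This makes pairings of multipliers with fluctuations converge. -/
theorem Dir.isCompact_inter {σ : Dir} {K L : Set (Spacetime N)} (hK : K ∈ σ.sets N)
    (hL : L ∈ σ.op.sets N) : IsCompact (K ∩ L) := by
  have key : ∀ K L : Set (Spacetime N), K ∈ Dir.adv.sets N → L ∈ Dir.ret.sets N →
      IsCompact (K ∩ L) := by
    rintro K L ⟨hK, t', ht'⟩ ⟨hL, t, ht⟩
    have : K ∩ L = (K ∩ {x | t' ≤ x.1 ∧ x.1 ≤ t}) ∩ L := by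
      ext x
      simp only [mem_inter_iff]
      exact ⟨fun h => ⟨⟨h.1, ht' h.1, ht h.2⟩, h.2⟩, fun h => ⟨h.1.1, h.2⟩⟩
    rw [this]
    exact (hK.2 t' t).inter_right hL.1
  cases σ with
  | adv => exact key K L hK hL
  | ret => exact inter_comm K L ▸ key L K hL hK

end Supports

/-! ### The integrated contraction of dual sections. -/

section Pairing

variable {B E : VBundle.{u, v} d N} {P : Type} [NormedAddCommGroup P] [NormedSpace ℝ P]

theorem contMDiff_ev {ζ : P → ∀ x, E.dual.fib x} {ξ : P → ∀ x, E.fib x} (hζ : SmoothField ζ)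
    (hξ : SmoothField ξ) : ContMDiff (𝓘(ℝ, P).prod (stModel d)) 𝓘(ℝ, ℝ) ∞
      (Function.uncurry fun p x => ev (ζ p x) (ξ p x)) := by
  have h : ContMDiff (𝓘(ℝ, P).prod (stModel d)) ((stModel d).prod 𝓘(ℝ, ℝ)) ∞
      (fun q : P × Spacetime N =>
        TotalSpace.mk' ℝ (E := Bundle.Trivial (Spacetime N) ℝ) q.2 (ev (ζ q.1 q.2) (ξ q.1 q.2))) :=
    ContMDiff.clm_bundle_apply (F₁ := E.F) (E₁ := E.fib) (F₂ := ℝ)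
      (E₂ := Bundle.Trivial (Spacetime N) ℝ) (b := fun q : P × Spacetime N => q.2)
      (ϕ := fun q => ζ q.1 q.2) (v := fun q => ξ q.1 q.2) hζ hξ
  intro q
  exact (contMDiffAt_totalSpace.1 (h q)).2

theorem ev_zero_left {x : Spacetime N} (w : E.fib x) : ev (E := E) (0 : E.dual.fib x) w = 0 := rfl

theorem ev_zero_right {x : Spacetime N} (a : E.dual.fib x) : ev (E := E) a (0 : E.fib x) = 0 :=
  map_zero (show E.fib x →L[ℝ] ℝ from a)

variable [MeasurableSpace N] (μ : Measure (Spacetime N))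

theorem pair_congr {ζ ζ' : Sec E.dual} {ξ ξ' : ∀ x, E.fib x}
    (h : ∀ x, ev (ζ x) (ξ x) = ev (ζ' x) (ξ' x)) : pair μ ζ ξ = pair μ ζ' ξ' := by
  simp only [pair, h]

theorem pair_zero_right (ζ : Sec E.dual) : pair μ ζ (0 : ∀ x, E.fib x) = 0 := by
  simp [pair, ev_zero_right]

theorem pair_eq_setIntegral {K : Set (Spacetime N)} {ζ : Sec E.dual} {ξ : ∀ x, E.fib x}
    (h : ∀ x ∉ K, ev (ζ x) (ξ x) = 0) : pair μ ζ ξ = ∫ x in K, ev (ζ x) (ξ x) ∂μ :=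
  (setIntegral_eq_integral_of_forall_compl_eq_zero h).symm

variable [BorelSpace N] [T2Space N] [SecondCountableTopology N] [IsManifold (𝓡 d) ∞ N]
  [IsFiniteMeasureOnCompacts μ]

theorem contDiff_pair {ζ : P → Sec E.dual} {ξ : P → Sec E} (hζ : SmoothFamily ζ)
    (hξ : SmoothFamily ξ) {K : Set (Spacetime N)} (hK : IsCompact K)
    (h : ∀ p, ∀ x ∉ K, ev (ζ p x) (ξ p x) = 0) : ContDiff ℝ ∞ (fun p => pair μ (ζ p) (ξ p)) := by
  have : (fun p => pair μ (ζ p) (ξ p)) = fun p => ∫ x in K, ev (ζ p x) (ξ p x) ∂μ :=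
    funext fun p => pair_eq_setIntegral μ (h p)
  rw [this, ← contDiffOn_univ]
  exact contDiffOn_setIntegral_of_contMDiffOn μ isOpen_univ hK
    (contMDiff_ev hζ.smoothField hξ.smoothField).contMDiffOn

theorem hasDerivAt_pair {ζ : Sec E.dual} {ξ : ℝ → Sec E} (hξ : SmoothFamily ξ)
    (hζ : IsCompact (supp ζ)) :
    HasDerivAt (fun t => pair μ ζ (ξ t)) (pair μ ζ hξ.velocity) 0 := by
  have h0 : ∀ (ξ : ∀ x, E.fib x), ∀ x ∉ supp ζ, ev (ζ x) (ξ x) = 0 := fun ξ x hx => by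
    rw [eq_zero_of_notMem_supp hx, ev_zero_left]
  have h := hasFDerivAt_setIntegral_of_contMDiffOn μ (U := (univ : Set ℝ)) isOpen_univ hζ
    (contMDiff_ev (smoothFamily_const ζ).smoothField hξ.smoothField).contMDiffOn (mem_univ 0)
  simp only [fun t => pair_eq_setIntegral μ (h0 (ξ t)), pair_eq_setIntegral μ (h0 hξ.velocity)]
  convert! h.hasDerivAt using 1
  have hd : ∀ x, ev (ζ x) (hξ.velocity x) =
      fderiv ℝ (fun t => ev (ζ x) (ξ t x)) 0 1 := fun x => by
    have h1 : HasDerivAt (fun t => ξ t x) (hξ.velocity x) 0 := hξ.hasVelocity x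
    have h2 : HasDerivAt (fun t => ev (ζ x) (ξ t x)) (ev (ζ x) (hξ.velocity x)) 0 :=
      (show E.fib x →L[ℝ] ℝ from ζ x).hasFDerivAt.comp_hasDerivAt 0 h1
    rw [← h2.deriv]
    rfl
  simp only [hd]
  rw [ContinuousLinearMap.integral_apply]
  have hc : Continuous (fun x => fderiv ℝ (fun t => ev (ζ x) (ξ t x)) 0) := by
    refine continuous_iff_continuousAt.2 fun x => ?_
    exact ContinuousAt.comp (f := fun x : Spacetime N => ((0 : ℝ), x)) (x := x)
      (contMDiffAt_fderiv_param (contMDiff_ev (smoothFamily_const ζ).smoothField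
        hξ.smoothField (0, x))).continuousAt (by fun_prop)
  exact hc.continuousOn.integrableOn_compact' hζ hζ.measurableSet

end Pairing

/-! ### Compactly supported cutoff functions and their filter. -/

section Cutoffs

variable (d N) in
/-- Smooth functions on the space-time with compact support. -/
structure Cutoff where
  toFun : Spacetime N → ℝ
  smooth : ContMDiff (stModel d) 𝓘(ℝ, ℝ) ∞ toFun
  compact : HasCompactSupport toFun

/-- The cutoff function is equal to `1` near the points of `L`. -/
def Cutoff.OneNear (χ : Cutoff d N) (L : Set (Spacetime N)) : Prop :=
  ∀ x ∈ L, ∀ᶠ y in 𝓝 x, χ.toFun y = 1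

variable (d N) in
/-- The filter of the cutoff functions equal to `1` near larger and larger compact sets. -/
def cutoffs : Filter (Cutoff d N) where
  sets := {S | ∃ L, IsCompact L ∧ ∀ χ : Cutoff d N, χ.OneNear L → χ ∈ S}
  univ_sets := ⟨∅, isCompact_empty, fun _ _ => mem_univ _⟩
  sets_of_superset := fun ⟨L, hL, h⟩ hST => ⟨L, hL, fun χ hχ => hST (h χ hχ)⟩
  inter_sets := fun ⟨L, hL, h⟩ ⟨L', hL', h'⟩ =>
    ⟨L ∪ L', hL.union hL', fun χ hχ =>
      ⟨h χ fun x hx => hχ x (Or.inl hx), h' χ fun x hx => hχ x (Or.inr hx)⟩⟩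

theorem eventually_oneNear {L : Set (Spacetime N)} (hL : IsCompact L) :
    ∀ᶠ χ in cutoffs d N, χ.OneNear L := ⟨L, hL, fun _ h => h⟩

variable {B E : VBundle.{u, v} d N}

/-- The product of a section with a cutoff function. -/
def Cutoff.mul (χ : Cutoff d N) (s : Sec E) : Sec E :=
  ⟨fun x => χ.toFun x • s x, χ.smooth.smul_section s.contMDiff⟩

theorem Cutoff.mul_apply (χ : Cutoff d N) (s : Sec E) (x : Spacetime N) :
    χ.mul s x = χ.toFun x • s x := rfl

theorem Cutoff.mul_eventually_eq {χ : Cutoff d N} {L : Set (Spacetime N)} (h : χ.OneNear L)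
    (s : Sec E) {x : Spacetime N} (hx : x ∈ L) : ∀ᶠ y in 𝓝 x, χ.mul s y = s y := by
  filter_upwards [h x hx] with y hy
  rw [χ.mul_apply, hy, one_smul]

theorem Cutoff.mul_eq {χ : Cutoff d N} {L : Set (Spacetime N)} (h : χ.OneNear L)
    (s : Sec E) {x : Spacetime N} (hx : x ∈ L) : χ.mul s x = s x :=
  (χ.mul_eventually_eq h s hx).self_of_nhds

theorem Cutoff.isCompact_supp_mul [T2Space N] (χ : Cutoff d N) (s : Sec E) :
    IsCompact (supp (χ.mul s)) :=
  χ.compact.of_isClosed_subset (isClosed_supp _) (supp_subset (isClosed_tsupport _) fun x hx => by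
    rw [χ.mul_apply, image_eq_zero_of_notMem_tsupport hx, zero_smul])

variable [T2Space N] [SecondCountableTopology N] [IsManifold (𝓡 d) ∞ N]

theorem exists_cutoff {L U : Set (Spacetime N)} (hL : IsCompact L) (hU : IsOpen U) (hLU : L ⊆ U) :
    ∃ χ : Cutoff d N, χ.OneNear L ∧ tsupport χ.toFun ⊆ U ∧ ∀ x, 0 ≤ χ.toFun x := by
  have : LocallyCompactSpace N := ChartedSpace.locallyCompactSpace (EuclideanSpace ℝ (Fin d)) N
  obtain ⟨K, hK, hLK, hKU⟩ := exists_compact_between hL hU hLU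
  obtain ⟨f, h1, h0, hf⟩ := exists_contMDiffMap_one_nhds_of_subset_interior (n := ⊤) (stModel d)
    hL.isClosed hLK
  have hs : tsupport f ⊆ K := closure_minimal (fun x hx => by_contra fun h => hx (h0 x h))
    hK.isClosed
  exact ⟨⟨f, f.contMDiff, hK.of_isClosed_subset (isClosed_tsupport _) hs⟩,
    fun x hx => (eventually_nhdsSet_iff_forall.1 h1) x hx, hs.trans hKU, fun x => (hf x).1⟩

/-- Lets a single cutoff be extracted at which finitely many eventual identities hold together. -/
instance neBot_cutoffs : (cutoffs d N).NeBot := by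
  refine ⟨fun h => ?_⟩
  have h0 : ∅ ∈ cutoffs d N := h ▸ mem_bot
  obtain ⟨L, hL, h1⟩ := h0
  obtain ⟨χ, hχ, -⟩ := exists_cutoff (d := d) hL isOpen_univ (subset_univ L)
  exact h1 χ hχ

end Cutoffs

/-! ### Compactly supported test sections detect a smooth section. -/

section Nondegeneracy

theorem continuous_ev {E : VBundle.{u, v} d N} (ζ : Sec E.dual) (ξ : Sec E) :
    Continuous (fun x => ev (ζ x) (ξ x)) :=
  (contMDiff_ev (P := ℝ) (smoothFamily_const ζ).smoothField
    (smoothFamily_const ξ).smoothField).continuous.comp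
      (by fun_prop : Continuous fun x => ((0 : ℝ), x))

variable {E : VBundle.{u, v} d N} [T2Space N] [SecondCountableTopology N] [IsManifold (𝓡 d) ∞ N]
  [MeasurableSpace N] [BorelSpace N] (μ : Measure (Spacetime N)) [IsFiniteMeasureOnCompacts μ]
  [μ.IsOpenPosMeasure]

/-- The pairing with the compactly supported sections of the dual bundle is nondegenerate. -/
theorem eq_zero_of_forall_pair_eq_zero {ξ : Sec E}
    (h : ∀ ζ : Sec E.dual, IsCompact (supp ζ) → pair μ ζ ξ = 0) : ξ = 0 := by
  by_contra hne
  obtain ⟨x₀, hx₀⟩ : ∃ x₀, ξ x₀ ≠ 0 := by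
    by_contra! hall
    exact hne (ContMDiffSection.ext hall)
  obtain ⟨α, -, hα⟩ := exists_dual_vector ℝ (ξ x₀) (norm_ne_zero_iff.2 hx₀)
  have hαpos : 0 < α (ξ x₀) := by
    rw [hα]
    simpa using hx₀
  -- A dual vector positive on `ξ x₀` is extended near `x₀` and made global by a first cutoff. A
  -- second cutoff, supported where the resulting pairing is positive, makes the integrand
  -- nonnegative.
  let η : ∀ x, E.dual.fib x := FiberBundle.extend E.dual.F (show E.dual.fib x₀ from α)
  obtain ⟨O, hO, hη⟩ := FiberBundle.exists_contMDiffOn_extend (k := ∞) (stModel d) E.dual.F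
    (V := E.dual.fib) (x₀ := x₀) (show E.dual.fib x₀ from α)
  obtain ⟨U, hUO, hU, hxU⟩ := mem_nhds_iff.1 hO
  obtain ⟨χ₁, hχ₁, hχ₁U, -⟩ := exists_cutoff (d := d) (isCompact_singleton (x := x₀)) hU
    (by simpa using hxU)
  let ζ₁ : Sec E.dual := ⟨χ₁.toFun • η, ContMDiffOn.smul_section_of_tsupport
    χ₁.smooth.contMDiffOn hU hχ₁U (hη.mono hUO)⟩
  have hζ₁ : ζ₁ x₀ = (show E.dual.fib x₀ from α) := by
    change χ₁.toFun x₀ • η x₀ = _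
    rw [(hχ₁ x₀ rfl).self_of_nhds, one_smul]
    exact FiberBundle.extend_apply_self _ _
  have hcont : ∀ ζ : Sec E.dual, Continuous (fun x => ev (ζ x) (ξ x)) := fun ζ =>
    continuous_ev ζ ξ
  have hpos : IsOpen {x | 0 < ev (ζ₁ x) (ξ x)} := isOpen_lt continuous_const (hcont ζ₁)
  have hx₀pos : 0 < ev (ζ₁ x₀) (ξ x₀) := by
    rw [hζ₁]
    exact hαpos
  obtain ⟨χ, hχ, hχU, hχ0⟩ := exists_cutoff (d := d) (isCompact_singleton (x := x₀)) hpos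
    (by simpa using hx₀pos)
  have hev : ∀ x, ev (χ.mul ζ₁ x) (ξ x) = χ.toFun x * ev (ζ₁ x) (ξ x) := fun x => rfl
  have hpair := h (χ.mul ζ₁) (χ.isCompact_supp_mul ζ₁)
  have hint : 0 < pair μ (χ.mul ζ₁) ξ := by
    refine (hcont (χ.mul ζ₁)).integral_pos_of_hasCompactSupport_nonneg_nonzero (x := x₀) ?_ ?_ ?_
    · refine HasCompactSupport.intro (χ.isCompact_supp_mul ζ₁) fun x hx => ?_
      rw [eq_zero_of_notMem_supp hx, ev_zero_left]
    · intro x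
      change 0 ≤ ev (χ.mul ζ₁ x) (ξ x)
      rw [hev]
      by_cases hx : x ∈ tsupport χ.toFun
      · exact mul_nonneg (hχ0 x) (le_of_lt (hχU hx))
      · rw [image_eq_zero_of_notMem_tsupport hx, zero_mul]
    · rw [hev, (hχ x₀ rfl).self_of_nhds, one_mul]
      exact hx₀pos.ne'
  exact hint.ne' hpair

end Nondegeneracy

/-! ### Compactly supported functionals and their gradients. -/

section Functionals

variable {B : VBundle.{u, v} d N} [MeasurableSpace N]
  {μ : Measure (Spacetime N)} {A : Sec B → ℝ}

theorem IsFunctional.smoothFunctional (hA : IsFunctional μ A) : SmoothFunctional A := hA.1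

theorem IsFunctional.exists_gradient (hA : IsFunctional μ A) :
    ∃ δA : Sec B → Sec B.dual, SupportedIn (compactSets N) δA ∧
      ∀ φ X, dirDeriv A φ X = pair μ (δA φ) X := by
  obtain ⟨hs, δA, -, hsupp, h⟩ := hA
  refine ⟨δA, hsupp, fun φ X => ?_⟩
  have h1 := (h _ X (smoothFamily_line φ X) (hasVelocity_line φ X)).deriv
  rwa [sec_zero_smul, add_zero] at h1

/-- The derivative of a functional depends on the direction only through its values on a compact
set, locally uniformly along smooth curves. -/
theorem IsFunctional.exists_compact (hA : IsFunctional μ A) {c : ℝ → Sec B}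
    (hc : SmoothFamily c) : ∃ K, IsCompact K ∧ ∀ᶠ s in 𝓝 (0 : ℝ), ∀ X X' : Sec B,
      (∀ x ∈ K, X x = X' x) → dirDeriv A (c s) X = dirDeriv A (c s) X' := by
  obtain ⟨δA, hsupp, h⟩ := hA.exists_gradient
  obtain ⟨K, hK, hKs⟩ := hsupp ℝ c hc 0
  refine ⟨K, hK, hKs.mono fun s hs X X' hX => ?_⟩
  rw [h, h]
  refine pair_congr μ fun x => ?_
  by_cases hx : x ∈ K
  · rw [hX x hx]
  · rw [eq_zero_of_notMem_supp fun h => hx (hs h), ev_zero_left, ev_zero_left]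

theorem IsFunctional.exists_compact_at (hA : IsFunctional μ A) (φ : Sec B) :
    ∃ K, IsCompact K ∧ ∀ X X' : Sec B, (∀ x ∈ K, X x = X' x) →
      dirDeriv A φ X = dirDeriv A φ X' := by
  obtain ⟨K, hK, h⟩ := hA.exists_compact (smoothFamily_const (P := ℝ) φ)
  exact ⟨K, hK, h.self_of_nhds⟩

theorem SupportedIn.exists_at {E : VBundle.{u, v} d N} {S : Set (Set (Spacetime N))}
    {X : Sec B → Sec E} (h : SupportedIn S X) (φ : Sec B) : ∃ K ∈ S, supp (X φ) ⊆ K := by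
  obtain ⟨K, hK, hs⟩ := h ℝ _ (smoothFamily_const φ) 0
  exact ⟨K, hK, hs.self_of_nhds⟩

theorem IsFunctional.exists_gradient_at [T2Space N] (hA : IsFunctional μ A) (φ : Sec B) :
    ∃ α : Sec B.dual, IsCompact (supp α) ∧ ∀ X : Sec B, dirDeriv A φ X = pair μ α X := by
  obtain ⟨δA, hsupp, h⟩ := hA.exists_gradient
  obtain ⟨K, hK, hKs⟩ := hsupp.exists_at φ
  exact ⟨δA φ, IsCompact.of_isClosed_subset hK (isClosed_supp _) hKs, h φ⟩

theorem SmoothFamily.sub {E : VBundle.{u, v} d N} {P : Type} [NormedAddCommGroup P]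
    [NormedSpace ℝ P] {φ ψ : P → Sec E} (h : SmoothFamily φ) (h' : SmoothFamily ψ) :
    SmoothFamily (fun p => φ p - ψ p) := by
  have h1 : (fun p => φ p - ψ p) = fun p => φ p + (-1 : ℝ) • ψ p := by
    funext p
    module
  rw [h1]
  exact h.add (h'.smul contDiff_const)

theorem integrable_ev [BorelSpace N] [T2Space N] [SecondCountableTopology N]
    [IsFiniteMeasureOnCompacts μ] {E : VBundle.{u, v} d N} {ζ : Sec E.dual}
    (hζ : IsCompact (supp ζ)) (ξ : Sec E) : Integrable (fun x => ev (ζ x) (ξ x)) μ := by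
  refine (continuous_ev ζ ξ).integrable_of_hasCompactSupport (HasCompactSupport.intro hζ fun x hx => ?_)
  rw [eq_zero_of_notMem_supp hx, ev_zero_left]

/-- A bracket is a difference of two functionals, and it must lie in the same class to enter an
outer bracket. -/
theorem IsFunctional.sub [BorelSpace N] [T2Space N] [SecondCountableTopology N]
    [IsFiniteMeasureOnCompacts μ] {A' : Sec B → ℝ} (hA : IsFunctional μ A)
    (hA' : IsFunctional μ A') : IsFunctional μ (fun φ => A φ - A' φ) := by
  obtain ⟨hs, α, hα, hαK, h⟩ := hA
  obtain ⟨hs', α', hα', hαK', h'⟩ := hA'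
  have hcompact : ∀ {β : Sec B → Sec B.dual} (_ : SupportedIn (compactSets N) β) (φ : Sec B),
      IsCompact (supp (β φ)) := fun hβ φ => by
    obtain ⟨K, hK, hβK⟩ := hβ.exists_at φ
    exact IsCompact.of_isClosed_subset hK (isClosed_supp _) hβK
  refine ⟨fun P _ _ _ φ hφ => (hs P φ hφ).sub (hs' P φ hφ), fun φ => α φ - α' φ,
    fun P _ _ _ φ hφ => (hα P φ hφ).sub (hα' P φ hφ), fun P _ _ _ φ hφ p => ?_,
    fun φ X hφ hX => ?_⟩
  · obtain ⟨K, hK, hsupp⟩ := hαK P φ hφ p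
    obtain ⟨K', hK', hsupp'⟩ := hαK' P φ hφ p
    refine ⟨K ∪ K', IsCompact.union hK hK', ?_⟩
    filter_upwards [hsupp, hsupp'] with q hq hq'
    exact (supp_sub_subset _ _).trans (union_subset_union hq hq')
  · convert! (h φ X hφ hX).sub (h' φ X hφ hX) using 1
    exact integral_sub (integrable_ev (hcompact hαK _) X) (integrable_ev (hcompact hαK' _) X)

end Functionals

/-! ### Multipliers, fluctuations and the Hessian on shell. -/

namespace FieldTheory

variable (𝒯 : FieldTheory.{u, v} d N)

/-- `γ` is a smooth curve in the shell that passes through `φ` with the velocity `Y`. -/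
structure IsShellCurve (γ : ℝ → Sec 𝒯.B) (φ Y : Sec 𝒯.B) : Prop where
  smooth : SmoothFamily γ
  mem_shell : ∀ s, γ s ∈ 𝒯.shell
  zero : γ 0 = φ
  velocity : HasVelocity γ Y

variable [IsManifold (𝓡 d) ∞ N] {𝒯}

/-- Identities known only on shell are differentiated through this lemma, hence only in directions
tangent to the shell. -/
theorem IsShellCurve.dirDeriv_eq_zero {γ : ℝ → Sec 𝒯.B} {φ Y : Sec 𝒯.B}
    (hγ : 𝒯.IsShellCurve γ φ Y) {f : Sec 𝒯.B → ℝ} (hf : SmoothFunctional f)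
    (h : ∀ᶠ s in 𝓝 (0 : ℝ), f (γ s) = 0) : dirDeriv f φ Y = 0 := by
  have h1 := hf.hasDerivAt hγ.smooth hγ.velocity
  rw [hγ.zero] at h1
  exact (h1.congr_of_eventuallyEq
    (show (fun _ : ℝ => (0 : ℝ)) =ᶠ[𝓝 0] _ from h.mono fun s hs => hs.symm)).unique
    (hasDerivAt_const _ _)

/-- The Jacobi operator with values in the smooth sections. -/
theorem J_eq_dir (φ W : Sec 𝒯.B) : 𝒯.J φ W = 𝒯.T_local.2.dir φ W := rfl

theorem J_congr {φ ψ W W' : Sec 𝒯.B} {x : Spacetime N} (h : ∀ᶠ y in 𝓝 x, φ y = ψ y)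
    (h' : ∀ᶠ y in 𝓝 x, W y = W' y) : 𝒯.J φ W x = 𝒯.J ψ W' x := by
  have key : ∀ s : ℝ, 𝒯.T (φ + s • W) x = 𝒯.T (ψ + s • W') x := fun s => by
    refine 𝒯.T_local.congr ?_
    filter_upwards [h, h'] with y hy hy'
    change φ y + s • W y = ψ y + s • W' y
    rw [hy, hy']
  simp only [J, key]

theorem J_congr_right (φ : Sec 𝒯.B) {W W' : Sec 𝒯.B} {x : Spacetime N}
    (h' : ∀ᶠ y in 𝓝 x, W y = W' y) : 𝒯.J φ W x = 𝒯.J φ W' x :=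
  J_congr (.of_forall fun _ => rfl) h'

theorem J_eq_zero (φ : Sec 𝒯.B) {W : Sec 𝒯.B} {x : Spacetime N} (h : x ∉ supp W) :
    𝒯.J φ W x = 0 :=
  eq_zero_of_notMem_supp fun hx => h (𝒯.T_local.dir_supp_subset φ W hx)

theorem eventually_V_congr (φ : Sec 𝒯.B) {a b : Sec 𝒯.E.dual} {x : Spacetime N}
    (h : ∀ᶠ y in 𝓝 x, a y = b y) : ∀ᶠ y in 𝓝 x, 𝒯.V φ a y = 𝒯.V φ b y := by
  filter_upwards [eventually_eventually_nhds.2 h] with y hy using 𝒯.V_local.congr_right φ hy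

variable [MeasurableSpace N] (μ : Measure (Spacetime N))

variable (𝒯) in
/-- The field equations contracted with the test section `b`, as a functional of the fields. -/
def test (b : Sec 𝒯.E.dual) (ψ : Sec 𝒯.B) : ℝ := pair μ b (𝒯.T ψ)

variable (𝒯) in
/-- The section `ζ` represents the derivative of `A` at `φ` in the form `δA = J^* ζ`. -/
structure IsMultiplier (σ : Dir) (φ : Sec 𝒯.B) (A : Sec 𝒯.B → ℝ) (ζ : Sec 𝒯.E.dual) : Prop where
  supp_mem : supp ζ ∈ σ.op.sets N
  dirDeriv_eq : ∀ h : Sec 𝒯.B, IsCompact (supp h) → dirDeriv A φ h = pair μ ζ (𝒯.J φ h)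

variable (𝒯) in
/-- The section `z` is the value at `φ` of a fluctuation caused by `A`. -/
structure IsResponse (σ : Dir) (φ : Sec 𝒯.B) (A : Sec 𝒯.B → ℝ) (z : Sec 𝒯.B) : Prop where
  supp_mem : supp z ∈ σ.sets N
  pair_eq : ∀ w : Sec 𝒯.E.dual, IsCompact (supp w) →
    pair μ w (𝒯.J φ z) = dirDeriv A φ (𝒯.V φ w)

variable {μ} {σ : Dir} {φ : Sec 𝒯.B} {A B C : Sec 𝒯.B → ℝ} {ζ ζA ζB ζC : Sec 𝒯.E.dual}

/-- The gradient of an observable is compactly supported and annihilated by `R^*`. A compact set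
belongs to both support classes, so dual exactness may be used in the direction opposite to `σ`. -/
theorem IsObservable.exists_isMultiplier [T2Space N] (hA : 𝒯.IsObservable μ A)
    (hdual : 𝒯.IsDualExact μ σ.op) (hφ : φ ∈ 𝒯.shell) : ∃ ζ, 𝒯.IsMultiplier μ σ φ A ζ := by
  obtain ⟨α, hα, hgrad⟩ := hA.1.exists_gradient_at φ
  have hcompact : ∀ (τ : Dir) (K : Set (Spacetime N)), IsCompact K → K ∈ τ.sets N := by
    intro τ K hK
    have hs : K ∈ spatiallyCompactSets N :=
      ⟨hK.isClosed, fun t' t => hK.inter_right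
        ((isClosed_le continuous_const continuous_fst).inter
          (isClosed_le continuous_fst continuous_const))⟩
    cases τ with
    | adv =>
      obtain ⟨t, ht⟩ := (hK.image continuous_fst).bddBelow
      exact ⟨hs, t, fun x hx => ht ⟨x, hx, rfl⟩⟩
    | ret =>
      obtain ⟨t, ht⟩ := (hK.image continuous_fst).bddAbove
      exact ⟨hs, t, fun x hx => ht ⟨x, hx, rfl⟩⟩
  obtain ⟨ζ, hζ, h⟩ := hdual φ hφ α (hcompact _ _ hα) fun ε hε => by
    rw [← hgrad, hA.2 φ hφ ε hε]
  exact ⟨ζ, hζ, fun k hk => by rw [hgrad, h k hk]⟩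

theorem IsFluctuation.isResponse {X : Sec 𝒯.B → Sec 𝒯.B} (hX : 𝒯.IsFluctuation μ σ A X)
    (hφ : φ ∈ 𝒯.shell) : 𝒯.IsResponse μ σ φ A (X φ) := by
  obtain ⟨K, hK, hs⟩ := hX.1.2.1.exists_at φ
  exact ⟨Dir.sets_mono hK (isClosed_supp _) hs, hX.2 φ hφ⟩

variable [BorelSpace N] [T2Space N] [SecondCountableTopology N] [IsFiniteMeasureOnCompacts μ]

theorem smoothFunctional_test {b : Sec 𝒯.E.dual} (hb : IsCompact (supp b)) :
    SmoothFunctional (𝒯.test μ b) := fun P _ _ _ c hc =>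
  contDiff_pair μ (smoothFamily_const b) (𝒯.T_local.2 P c hc) hb fun p x hx => by
    rw [eq_zero_of_notMem_supp hx, ev_zero_left]

theorem dirDeriv_test {b : Sec 𝒯.E.dual} (hb : IsCompact (supp b)) (φ W : Sec 𝒯.B) :
    dirDeriv (𝒯.test μ b) φ W = pair μ b (𝒯.J φ W) :=
  (hasDerivAt_pair μ (𝒯.T_local.2.line φ W) hb).deriv

theorem smoothFunctional_test_mul (χ : Cutoff d N) (ζ : Sec 𝒯.E.dual) :
    SmoothFunctional (𝒯.test μ (χ.mul ζ)) := smoothFunctional_test (χ.isCompact_supp_mul ζ)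

/-- The equation of a fluctuation, extended to noncompact test sections. The cutoff is fixed before
`s` varies, so that both sides can be differentiated along the curve; this relies on the gradient of
`A` having locally uniform compact support. -/
theorem IsFluctuation.eventually_dirDeriv_test {X : Sec 𝒯.B → Sec 𝒯.B}
    (hX : 𝒯.IsFluctuation μ σ A X) (hA : IsFunctional μ A) {c : ℝ → Sec 𝒯.B}
    (hc : SmoothFamily c) (hcs : ∀ s, c s ∈ 𝒯.shell) (ζ : Sec 𝒯.E.dual) :
    ∀ᶠ χ in cutoffs d N, ∀ᶠ s in 𝓝 (0 : ℝ),
      dirDeriv (𝒯.test μ (χ.mul ζ)) (c s) (X (c s)) = dirDeriv A (c s) (𝒯.V (c s) ζ) := by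
  obtain ⟨K, hK, h⟩ := hA.exists_compact hc
  filter_upwards [eventually_oneNear hK] with χ hχ
  filter_upwards [h] with s hs
  rw [dirDeriv_test (χ.isCompact_supp_mul ζ), hX.2 _ (hcs s) _ (χ.isCompact_supp_mul ζ)]
  exact hs _ _ fun x hx => 𝒯.V_local.congr_right _ (χ.mul_eventually_eq hχ ζ hx)

/-- Extends `δA = J^* ζ` to noncompact directions. Cutting `W` off does not affect `δA`, whose
support is compact, nor the pairing, since `J W` and `ζ` overlap only in a compact set. -/
theorem IsMultiplier.eventually_dirDeriv_test (hζ : 𝒯.IsMultiplier μ σ φ A ζ)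
    (hA : IsFunctional μ A) {W : Sec 𝒯.B} (hW : IsCompact (supp ζ ∩ supp W)) :
    ∀ᶠ χ in cutoffs d N, dirDeriv (𝒯.test μ (χ.mul ζ)) φ W = dirDeriv A φ W := by
  obtain ⟨K, hK, h⟩ := hA.exists_compact_at φ
  filter_upwards [eventually_oneNear hK, eventually_oneNear hW] with χ hχ hχ'
  rw [dirDeriv_test (χ.isCompact_supp_mul ζ), h W (χ.mul W) fun x hx => (χ.mul_eq hχ W hx).symm,
    hζ.dirDeriv_eq _ (χ.isCompact_supp_mul W)]
  refine pair_congr μ fun x => ?_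
  by_cases hx : x ∈ supp ζ
  · by_cases hxW : x ∈ supp W
    · rw [χ.mul_eq hχ' ζ ⟨hx, hxW⟩, J_congr_right φ (χ.mul_eventually_eq hχ' W ⟨hx, hxW⟩)]
    · have h0 : x ∉ supp (χ.mul W) := fun h1 => hxW (supp_subset (isClosed_supp W)
        (fun y hy => by rw [χ.mul_apply, eq_zero_of_notMem_supp hy, smul_zero]) h1)
      rw [J_eq_zero φ hxW, J_eq_zero φ h0, ev_zero_right, ev_zero_right]
  · rw [χ.mul_apply, eq_zero_of_notMem_supp hx, smul_zero, ev_zero_left, ev_zero_left]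

theorem IsMultiplier.eventually_of_mem_sets (hζ : 𝒯.IsMultiplier μ σ φ A ζ)
    (hA : IsFunctional μ A) {W : Sec 𝒯.B} {K : Set (Spacetime N)} (hK : K ∈ σ.sets N)
    (hW : supp W ⊆ K) :
    ∀ᶠ χ in cutoffs d N, dirDeriv (𝒯.test μ (χ.mul ζ)) φ W = dirDeriv A φ W :=
  hζ.eventually_dirDeriv_test hA <| inter_comm (supp W) (supp ζ) ▸
    Dir.isCompact_inter (Dir.sets_mono hK (isClosed_supp W) hW) hζ.supp_mem

/-- The second derivative at `φ` of the functional `A` with the Lagrange multiplier `ζ`. -/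
def hess (μ : Measure (Spacetime N)) (A : Sec 𝒯.B → ℝ) (ζ : Sec 𝒯.E.dual) (φ : Sec 𝒯.B)
    (χ : Cutoff d N) (X Y : Sec 𝒯.B) : ℝ :=
  dirDeriv₂ A φ X Y - dirDeriv₂ (𝒯.test μ (χ.mul ζ)) φ X Y

theorem hess_sub_left (hA : IsFunctional μ A) (ζ : Sec 𝒯.E.dual) (φ : Sec 𝒯.B) (χ : Cutoff d N)
    (X X' Y : Sec 𝒯.B) : hess μ A ζ φ χ (X - X') Y = hess μ A ζ φ χ X Y - hess μ A ζ φ χ X' Y := by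
  simp only [hess, hA.smoothFunctional.dirDeriv₂_sub_left, (smoothFunctional_test_mul χ ζ).dirDeriv₂_sub_left]
  ring

theorem hess_comm (hA : IsFunctional μ A) (ζ : Sec 𝒯.E.dual) (φ : Sec 𝒯.B) (χ : Cutoff d N)
    (X Y : Sec 𝒯.B) : hess μ A ζ φ χ X Y = hess μ A ζ φ χ Y X := by
  simp only [hess, hA.smoothFunctional.dirDeriv₂_comm φ X, (smoothFunctional_test_mul χ ζ).dirDeriv₂_comm φ X]

theorem hess_sub_right (hA : IsFunctional μ A) (ζ : Sec 𝒯.E.dual) (φ : Sec 𝒯.B) (χ : Cutoff d N)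
    (X Y Y' : Sec 𝒯.B) :
    hess μ A ζ φ χ X (Y - Y') = hess μ A ζ φ χ X Y - hess μ A ζ φ χ X Y' := by
  rw [hess_comm hA, hess_sub_left hA, hess_comm hA ζ φ χ Y, hess_comm hA ζ φ χ Y']

/-- The derivative of `V_a A` along `Y`. -/
def anchorDir (A : Sec 𝒯.B → ℝ) (ζ : Sec 𝒯.E.dual) (φ Y : Sec 𝒯.B) : ℝ :=
  dirDeriv (fun ψ => dirDeriv A ψ (𝒯.V ψ ζ)) φ Y

theorem anchorDir_eq (hA : SmoothFunctional A) (ζ : Sec 𝒯.E.dual) (φ Y : Sec 𝒯.B) :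
    anchorDir A ζ φ Y = dirDeriv₂ A φ Y (𝒯.V φ ζ) +
      dirDeriv A φ ((𝒯.V_local.smoothMap ζ).dir φ Y) :=
  hA.dirDeriv_dirDeriv (𝒯.V_local.smoothMap ζ) φ Y

/-- Invariance is assumed for compactly supported parameters; `ε` is cut off outside a compact set
that serves all nearby points of the curve. -/
theorem eventually_vanish_gauge (hA : 𝒯.IsObservable μ A) {c : ℝ → Sec 𝒯.B}
    (hc : SmoothFamily c) (hcs : ∀ s, c s ∈ 𝒯.shell) (ε : Sec 𝒯.G) :
    ∀ᶠ s in 𝓝 (0 : ℝ), dirDeriv A (c s) (𝒯.R (c s) ε) = 0 := by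
  obtain ⟨K, hK, h⟩ := hA.1.exists_compact hc
  obtain ⟨χ, hχ⟩ := (eventually_oneNear (d := d) hK).exists
  filter_upwards [h] with s hs
  rw [← hA.2 _ (hcs s) _ (χ.isCompact_supp_mul ε)]
  exact hs _ _ fun x hx => 𝒯.R_local.congr_right _ ((χ.mul_eventually_eq hχ ε hx).mono
    fun y hy => hy.symm)

theorem dirDeriv_gauge (hA : 𝒯.IsObservable μ A) (hφ : φ ∈ 𝒯.shell) (ε : Sec 𝒯.G) :
    dirDeriv A φ (𝒯.R φ ε) = 0 :=
  (eventually_vanish_gauge hA (smoothFamily_const (P := ℝ) φ) (fun _ => hφ) ε).self_of_nhds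

/-- The second derivative of an observable on shell vanishes on the gauge directions. -/
theorem eventually_hess_gauge (hgauge : 𝒯.IsGaugeSymmetry) (hA : 𝒯.IsObservable μ A)
    (hζ : 𝒯.IsMultiplier μ σ φ A ζ) {γ : ℝ → Sec 𝒯.B} {Y : Sec 𝒯.B}
    (hγ : 𝒯.IsShellCurve γ φ Y) {ε : Sec 𝒯.G} (hε : supp ε ∈ σ.sets N) :
    ∀ᶠ χ in cutoffs d N, hess μ A ζ φ χ Y (𝒯.R φ ε) = 0 := by
  obtain ⟨C, -, hC⟩ := hgauge
  have hR := 𝒯.R_local.smoothMap ε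
  filter_upwards [hζ.eventually_of_mem_sets hA.1 hε (𝒯.R_local.dir_supp_subset ε φ Y)] with χ hχ
  have htest := smoothFunctional_test_mul (μ := μ) χ ζ
  -- Both `δA (R ε)` and `J (R ε)` vanish along the shell. After differentiation, the terms with the
  -- derivative of `R` agree because `δA = J^* ζ`, so the second derivatives agree too.
  have h1 := hγ.dirDeriv_eq_zero (hA.1.smoothFunctional.dirDeriv_along hR)
    (eventually_vanish_gauge hA hγ.smooth hγ.mem_shell ε)
  have h2 := hγ.dirDeriv_eq_zero (htest.dirDeriv_along hR) (.of_forall fun s => by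
    rw [dirDeriv_test (χ.isCompact_supp_mul ζ)]
    have h0 : 𝒯.J (γ s) (𝒯.R (γ s) ε) = 0 := funext fun x => by
      rw [hC, show 𝒯.T (γ s) = 0 from hγ.mem_shell s, map_zero]
      rfl
    rw [h0, pair_zero_right])
  rw [hA.1.smoothFunctional.dirDeriv_dirDeriv hR] at h1
  rw [htest.dirDeriv_dirDeriv hR] at h2
  rw [hess]
  linarith

variable [μ.IsOpenPosMeasure]

theorem J_eq_zero_of_forall_pair {W : Sec 𝒯.B}
    (h : ∀ w : Sec 𝒯.E.dual, IsCompact (supp w) → pair μ w (𝒯.J φ W) = 0) (x : Spacetime N) :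
    𝒯.J φ W x = 0 := by
  have h0 : 𝒯.T_local.2.dir φ W = 0 := eq_zero_of_forall_pair_eq_zero μ h
  rw [J_eq_dir, h0]
  rfl

/-- The second derivative of an observable on shell does not depend on the choice of fluctuations.
-/
theorem eventually_hess_response (hgauge : 𝒯.IsGaugeSymmetry) (hexact : 𝒯.IsExact σ)
    (hφ : φ ∈ 𝒯.shell) (hA : 𝒯.IsObservable μ A) (hζ : 𝒯.IsMultiplier μ σ φ A ζ)
    {γ : ℝ → Sec 𝒯.B} {Y : Sec 𝒯.B} (hγ : 𝒯.IsShellCurve γ φ Y) {z z' : Sec 𝒯.B}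
    (hz : 𝒯.IsResponse μ σ φ B z) (hz' : 𝒯.IsResponse μ σ φ B z') :
    ∀ᶠ χ in cutoffs d N, hess μ A ζ φ χ Y z = hess μ A ζ φ χ Y z' := by
  -- Two responses to the same functional differ by a solution of the linearized equations, which
  -- exactness makes a gauge direction.
  have hJ : ∀ x, 𝒯.J φ (z - z') x = 0 := J_eq_zero_of_forall_pair (μ := μ) fun w hw => by
    rw [← dirDeriv_test hw, (smoothFunctional_test hw).dirDeriv_sub, dirDeriv_test hw,
      dirDeriv_test hw, hz.pair_eq w hw, hz'.pair_eq w hw, sub_self]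
  obtain ⟨ε, hε, hzε⟩ := hexact φ hφ (z - z') (Dir.sets_mono
    (Dir.sets_union hz.supp_mem hz'.supp_mem) (isClosed_supp _) (supp_sub_subset z z')) hJ
  filter_upwards [eventually_hess_gauge hgauge hA hζ hγ hε] with χ hχ
  rwa [← hzε, hess_sub_right hA.1, sub_eq_zero] at hχ

/-- `V^i ζ - z^i` is tangent to the shell for a Lagrange multiplier `ζ` and a fluctuation `z` of one
and the same functional. -/
theorem exists_isShellCurve (hregular : 𝒯.IsRegular) (hanchor : 𝒯.IsLagrangeStructure μ)
    (hφ : φ ∈ 𝒯.shell) (hζ : 𝒯.IsMultiplier μ σ φ A ζ) {z : Sec 𝒯.B}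
    (hz : 𝒯.IsResponse μ σ φ A z) : ∃ γ, 𝒯.IsShellCurve γ φ (𝒯.V φ ζ - z) := by
  obtain ⟨S, D, W, -, -, -, hS, -, -⟩ := hanchor
  have hsupp : supp (𝒯.V φ ζ - z) ∈ spatiallyCompactSets N :=
    spatiallyCompactSets.mono (spatiallyCompactSets.union
      (Dir.spatiallyCompact (Dir.sets_mono hζ.supp_mem (isClosed_supp _)
        (𝒯.V_local.supp_subset φ ζ))) (Dir.spatiallyCompact hz.supp_mem))
      (isClosed_supp _) (supp_sub_subset _ _)
  have hJ : ∀ x, 𝒯.J φ (𝒯.V φ ζ - z) x = 0 := J_eq_zero_of_forall_pair (μ := μ) fun w hw => by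
    -- On shell the anchor is symmetric: `⟨w, J V ζ⟩ = ⟨ζ, J V w⟩ = δA (V w) = ⟨w, J z⟩`. The
    -- symmetry is given for compact supports, so `ζ` is cut off away from `supp w`, which changes
    -- neither pairing.
    obtain ⟨χ, hχ⟩ := (eventually_oneNear (d := d) hw).exists
    have hVw : supp (𝒯.V φ w) ⊆ supp w := 𝒯.V_local.supp_subset φ w
    have h1 : pair μ w (𝒯.J φ (𝒯.V φ ζ)) = pair μ w (𝒯.J φ (𝒯.V φ (χ.mul ζ))) :=
      pair_congr μ fun x => by
        by_cases hx : x ∈ supp w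
        · rw [J_congr_right φ (eventually_V_congr φ (χ.mul_eventually_eq hχ ζ hx))]
        · rw [eq_zero_of_notMem_supp hx, ev_zero_left, ev_zero_left]
    have h2 : pair μ (χ.mul ζ) (𝒯.J φ (𝒯.V φ w)) = pair μ ζ (𝒯.J φ (𝒯.V φ w)) :=
      pair_congr μ fun x => by
        by_cases hx : x ∈ supp w
        · rw [χ.mul_eq hχ ζ hx]
        · rw [J_eq_zero φ fun h => hx (hVw h), ev_zero_right, ev_zero_right]
    have h3 := hS φ (χ.mul ζ) w (χ.isCompact_supp_mul ζ) hw
    rw [show 𝒯.T φ = 0 from hφ, ContMDiffSection.coe_zero, pair_zero_right] at h3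
    have h4 := hζ.dirDeriv_eq (𝒯.V φ w) (hw.of_isClosed_subset (isClosed_supp _) hVw)
    rw [← dirDeriv_test hw, (smoothFunctional_test hw).dirDeriv_sub, dirDeriv_test hw,
      dirDeriv_test hw, hz.pair_eq w hw]
    linarith
  obtain ⟨γ, h1, h2, h3, h4⟩ := hregular φ hφ _ hsupp hJ
  exact ⟨γ, h1, h2, h3, h4⟩

end FieldTheory

/-! ### The iterated bracket on shell and the cyclic sum. -/

namespace FieldTheory

variable {𝒯 : FieldTheory.{u, v} d N} [IsManifold (𝓡 d) ∞ N] [MeasurableSpace N]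
  {μ : Measure (Spacetime N)} {σ : Dir} {φ : Sec 𝒯.B} {A B C : Sec 𝒯.B → ℝ}
  {ζA ζB ζC : Sec 𝒯.E.dual} [BorelSpace N] [T2Space N] [SecondCountableTopology N]
  [IsFiniteMeasureOnCompacts μ]

theorem anchorDir_sub (hA : SmoothFunctional A) (ζ : Sec 𝒯.E.dual) (φ Y Y' : Sec 𝒯.B) :
    anchorDir A ζ φ (Y - Y') = anchorDir A ζ φ Y - anchorDir A ζ φ Y' :=
  (hA.dirDeriv_along (𝒯.V_local.smoothMap ζ)).dirDeriv_sub φ Y Y'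

/-- The derivative of `V_A B` along a direction tangent to the shell. -/
theorem eventually_dirDeriv_fluctuation (hA : IsFunctional μ A) (hB : IsFunctional μ B)
    {X : Sec 𝒯.B → Sec 𝒯.B} (hX : 𝒯.IsFluctuation μ σ A X) (hζB : 𝒯.IsMultiplier μ σ φ B ζB)
    {γ : ℝ → Sec 𝒯.B} {Y : Sec 𝒯.B} (hγ : 𝒯.IsShellCurve γ φ Y) :
    ∀ᶠ χ in cutoffs d N, dirDeriv (fun ψ => dirDeriv B ψ (X ψ)) φ Y =
      hess μ B ζB φ χ Y (X φ) + anchorDir A ζB φ Y := by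
  obtain ⟨hXs, hXS, -⟩ := hX.1
  obtain ⟨K, hK, hXK⟩ := hXS.exists_dir (fun K hK => Dir.isClosed hK) hXs φ Y
  filter_upwards [hζB.eventually_of_mem_sets hB hK hXK,
    hX.eventually_dirDeriv_test hA hγ.smooth hγ.mem_shell ζB] with χ h1 h2
  have htest := smoothFunctional_test_mul (μ := μ) χ ζB
  have hV := hA.smoothFunctional.dirDeriv_along (𝒯.V_local.smoothMap ζB)
  -- Differentiating the equation of the fluctuation along the shell expresses the unknown
  -- derivative of `X`, paired with `δB = J^* ζB`, through known quantities.
  have h3 := hγ.dirDeriv_eq_zero ((htest.dirDeriv_along hXs).sub hV) (h2.mono fun s hs => by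
    rw [hs, sub_self])
  rw [dirDeriv_sub_functional (htest.dirDeriv_along hXs) hV, htest.dirDeriv_dirDeriv hXs, h1] at h3
  rw [hB.smoothFunctional.dirDeriv_dirDeriv hXs, hess]
  have h4 : anchorDir A ζB φ Y = dirDeriv (fun ψ => dirDeriv A ψ (𝒯.V ψ ζB)) φ Y := rfl
  linarith

/-- The derivative of `ψ ↦ b^a J_{ai} V^i_c η^c` along `z` only involves `η` near the support of
`z`. -/
theorem dirDeriv_test_V_eq_zero {b η : Sec 𝒯.E.dual} (hb : IsCompact (supp b)) {z : Sec 𝒯.B}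
    (hη : ∀ x ∈ supp z, ∀ᶠ y in 𝓝 x, η y = 0) :
    dirDeriv (fun ψ => dirDeriv (𝒯.test μ b) ψ (𝒯.V ψ η)) φ z = 0 := by
  have hconst : ∀ s : ℝ, dirDeriv (𝒯.test μ b) (φ + s • z) (𝒯.V (φ + s • z) η) =
      dirDeriv (𝒯.test μ b) φ (𝒯.V φ η) := fun s => by
    rw [dirDeriv_test hb, dirDeriv_test hb]
    refine pair_congr μ fun x => ?_
    -- On `supp z` both values vanish, since `η` does so nearby; off `supp z` the field does not
    -- depend on `s`.
    by_cases hx : x ∈ supp z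
    · have h0 : ∀ ψ : Sec 𝒯.B, 𝒯.J ψ (𝒯.V ψ η) x = 0 := fun ψ =>
        J_eq_zero ψ fun h => by
          have hxη : x ∈ supp η := 𝒯.V_local.supp_subset ψ η h
          obtain ⟨y, hy, hy0⟩ := ((mem_closure_iff_frequently.1 hxη).and_eventually (hη x hx)).exists
          exact hy hy0
      rw [h0, h0]
    · have hφ : ∀ᶠ y in 𝓝 x, (φ + s • z) y = φ y := by
        filter_upwards [eventually_eq_zero_of_notMem_supp hx] with y hy
        change φ y + s • z y = φ y
        rw [hy, smul_zero, add_zero]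
      rw [J_congr hφ]
      filter_upwards [eventually_eventually_nhds.2 hφ] with y hy
      exact 𝒯.V_local.congr hy (.of_forall fun _ => rfl)
  rw [dirDeriv]
  simp only [hconst]
  simp

/-- The derivative of `Z` is paired with `T φ = 0`, so on shell only the derivative of `T` survives.
-/
theorem dirDeriv_pair_T {Z : Sec 𝒯.B → Sec 𝒯.E.dual} (hZ : SmoothMap Z)
    {K : Set (Spacetime N)} (hK : IsCompact K) (hZK : ∀ ψ, supp (Z ψ) ⊆ K) (hφ : φ ∈ 𝒯.shell)
    (z : Sec 𝒯.B) :
    dirDeriv (fun ψ => pair μ (Z ψ) (𝒯.T ψ)) φ z = pair μ (Z φ) (𝒯.J φ z) := by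
  have hc : ContDiff ℝ ∞ (fun q : ℝ × ℝ => pair μ (Z (φ + q.1 • z)) (𝒯.T (φ + q.2 • z))) :=
    contDiff_pair μ ((hZ.line φ z).comp contDiff_fst)
      ((𝒯.T_local.2.line φ z).comp contDiff_snd) hK fun q x hx => by
        rw [eq_zero_of_notMem_supp fun h => hx (hZK _ h), ev_zero_left]
  have hd := (hc.differentiable (by simp) (0, 0)).hasFDerivAt
  have h1 : HasDerivAt (fun t : ℝ => pair μ (Z (φ + t • z)) (𝒯.T (φ + (0 : ℝ) • z))) _ 0 :=
    hd.comp_hasDerivAt (f := fun t : ℝ => (t, (0 : ℝ))) 0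
      ((hasDerivAt_id _).prodMk (hasDerivAt_const _ _))
  have h2 : HasDerivAt (fun t : ℝ => pair μ (Z (φ + (0 : ℝ) • z)) (𝒯.T (φ + t • z))) _ 0 :=
    hd.comp_hasDerivAt (f := fun t : ℝ => ((0 : ℝ), t)) 0
      ((hasDerivAt_const _ _).prodMk (hasDerivAt_id _))
  have h3 : HasDerivAt (fun t : ℝ => pair μ (Z (φ + t • z)) (𝒯.T (φ + t • z))) _ 0 :=
    hd.comp_hasDerivAt (f := fun t : ℝ => (t, t)) 0
      ((hasDerivAt_id _).prodMk (hasDerivAt_id _))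
  simp only [sec_zero_smul, add_zero] at h1 h2
  simp only [show 𝒯.T φ = 0 from hφ, ContMDiffSection.coe_zero, pair_zero_right] at h1
  have h4 := h1.unique (hasDerivAt_const _ _)
  have h5 : dirDeriv (𝒯.test μ (Z φ)) φ z = _ := h2.deriv
  rw [dirDeriv_test (hK.of_isClosed_subset (isClosed_supp _) (hZK φ))] at h5
  rw [h5]
  refine h3.deriv.trans ?_
  have hsum : ((1 : ℝ), (1 : ℝ)) = (1, 0) + (0, 1) := by simp
  rw [hsum, map_add, h4, zero_add]

/-- The compatibility of the anchor with the field equations, differentiated along a fluctuation. -/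
theorem eventually_anchorDir_response
    {S : Sec 𝒯.B → Sec 𝒯.E.dual →ₗ[ℝ] Sec 𝒯.E.dual →ₗ[ℝ] Sec 𝒯.E.dual} (hSl : IsLocalBiop S)
    (hS : ∀ (φ : Sec 𝒯.B) (a b : Sec 𝒯.E.dual), IsCompact (supp a) → IsCompact (supp b) →
      pair μ b (𝒯.J φ (𝒯.V φ a)) - pair μ a (𝒯.J φ (𝒯.V φ b)) = pair μ (S φ a b) (𝒯.T φ))
    (hφ : φ ∈ 𝒯.shell) (hA : IsFunctional μ A) (hB : IsFunctional μ B) (hC : IsFunctional μ C)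
    (hζA : 𝒯.IsMultiplier μ σ φ A ζA) (hζB : 𝒯.IsMultiplier μ σ φ B ζB) {z : Sec 𝒯.B}
    (hz : 𝒯.IsResponse μ σ φ C z) :
    ∀ᶠ χ in cutoffs d N, anchorDir A ζB φ z - anchorDir B ζA φ z =
      hess μ A ζA φ χ z (𝒯.V φ ζB) - hess μ B ζB φ χ z (𝒯.V φ ζA) +
        dirDeriv C φ (𝒯.V φ (S φ ζB ζA)) := by
  obtain ⟨K, hK, hCK⟩ := hC.exists_compact_at φ
  have hdir : ∀ ζ : Sec 𝒯.E.dual, supp ((𝒯.V_local.smoothMap ζ).dir φ z) ⊆ supp z := fun ζ =>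
    𝒯.V_local.dir_supp_subset_dir ζ φ z
  -- Compatibility of the anchor needs compact support in both arguments, while the Leibniz rule
  -- below uses the full `ζ'` inside `V`; the difference is not seen by the derivative along `z`.
  have hcut : ∀ (ζ ζ' : Sec 𝒯.E.dual) (χ : Cutoff d N), χ.OneNear (supp z ∩ supp ζ') →
      dirDeriv (fun ψ => dirDeriv (𝒯.test μ (χ.mul ζ)) ψ (𝒯.V ψ (χ.mul ζ'))) φ z =
        dirDeriv (fun ψ => dirDeriv (𝒯.test μ (χ.mul ζ)) ψ (𝒯.V ψ ζ')) φ z := by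
    intro ζ ζ' χ hχ
    have htest := smoothFunctional_test_mul (μ := μ) χ ζ
    have h0 := dirDeriv_test_V_eq_zero (μ := μ) (φ := φ) (χ.isCompact_supp_mul ζ)
      (η := χ.mul ζ' - ζ') (z := z) fun x hx => by
        by_cases hx' : x ∈ supp ζ'
        · filter_upwards [χ.mul_eventually_eq hχ ζ' ⟨hx, hx'⟩] with y hy
          exact sub_eq_zero.2 hy
        · filter_upwards [eventually_eq_zero_of_notMem_supp hx'] with y hy
          change χ.toFun y • ζ' y - ζ' y = 0
          rw [hy, smul_zero, sub_zero]
    simp only [map_sub, htest.dirDeriv_sub] at h0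
    rw [dirDeriv_sub_functional (htest.dirDeriv_along (𝒯.V_local.smoothMap _))
      (htest.dirDeriv_along (𝒯.V_local.smoothMap _))] at h0
    exact sub_eq_zero.1 h0
  filter_upwards [hζA.eventually_of_mem_sets hA hz.supp_mem (hdir ζB),
    hζB.eventually_of_mem_sets hB hz.supp_mem (hdir ζA), eventually_oneNear hK,
    eventually_oneNear (Dir.isCompact_inter hz.supp_mem hζA.supp_mem),
    eventually_oneNear (Dir.isCompact_inter hz.supp_mem hζB.supp_mem)] with χ h1 h2 hχK hχA hχB
  have hA' := smoothFunctional_test_mul (μ := μ) χ ζA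
  have hB' := smoothFunctional_test_mul (μ := μ) χ ζB
  have hcA := χ.isCompact_supp_mul ζA
  have hcB := χ.isCompact_supp_mul ζB
  have hSm : SmoothMap (fun ψ => S ψ (χ.mul ζB) (χ.mul ζA)) := fun P _ _ _ c hc =>
    hSl.2 P c _ _ hc (smoothFamily_const _) (smoothFamily_const _)
  have hSc : ∀ ψ, supp (S ψ (χ.mul ζB) (χ.mul ζA)) ⊆ supp (χ.mul ζB) := fun ψ =>
    hSl.supp_subset_left ψ _ _
  -- Since the compatibility identity holds on all fields, it may be differentiated along `z`, which
  -- need not be tangent to the shell. The right side gives `⟨S, J z⟩`, rewritten by the response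
  -- equation.
  have key : dirDeriv (fun ψ => dirDeriv (𝒯.test μ (χ.mul ζA)) ψ (𝒯.V ψ (χ.mul ζB)) -
      dirDeriv (𝒯.test μ (χ.mul ζB)) ψ (𝒯.V ψ (χ.mul ζA))) φ z =
        dirDeriv C φ (𝒯.V φ (S φ ζB ζA)) := by
    simp only [dirDeriv_test hcA, dirDeriv_test hcB, hS _ _ _ hcB hcA]
    rw [dirDeriv_pair_T hSm hcB hSc hφ, hz.pair_eq _ (hcB.of_isClosed_subset (isClosed_supp _)
      (hSc φ))]
    refine hCK _ _ fun x hx => 𝒯.V_local.congr_right φ ?_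
    filter_upwards [eventually_eventually_nhds.2 (χ.mul_eventually_eq hχK ζB hx),
      eventually_eventually_nhds.2 (χ.mul_eventually_eq hχK ζA hx)] with y hy hy'
    exact hSl.congr φ hy hy'
  rw [dirDeriv_sub_functional (hA'.dirDeriv_along (𝒯.V_local.smoothMap _))
    (hB'.dirDeriv_along (𝒯.V_local.smoothMap _)), hcut ζA ζB χ hχB, hcut ζB ζA χ hχA,
    hA'.dirDeriv_dirDeriv (𝒯.V_local.smoothMap ζB), hB'.dirDeriv_dirDeriv (𝒯.V_local.smoothMap ζA),
    h1, h2] at key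
  rw [anchorDir_eq hA.smoothFunctional, anchorDir_eq hB.smoothFunctional, hess, hess]
  linarith

/-- The iterated bracket on shell as a derivative along the shell. -/
theorem dirDeriv_bracket_eq (hφ : φ ∈ 𝒯.shell) (hC : IsFunctional μ C) {H : Sec 𝒯.B → ℝ}
    (hH : IsFunctional μ H) (hζC : 𝒯.IsMultiplier μ σ φ C ζC) {U : Sec 𝒯.B → Sec 𝒯.B}
    (hU : 𝒯.IsFluctuation μ σ H U) (z : Sec 𝒯.B) :
    dirDeriv C φ (U φ) - dirDeriv H φ z = dirDeriv H φ (𝒯.V φ ζC - z) := by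
  -- The multiplier gives `δC (U) = ⟨ζC, J U⟩`, and the fluctuation equation turns this into the
  -- derivative of `H` along `V ζC`.
  obtain ⟨χ, h1, h2⟩ := ((hU.eventually_dirDeriv_test hH (smoothFamily_const (P := ℝ) φ)
    (fun _ => hφ) ζC).and (hζC.eventually_of_mem_sets hC (hU.isResponse hφ).supp_mem
      subset_rfl)).exists
  rw [hH.smoothFunctional.dirDeriv_sub, ← h2, h1.self_of_nhds]

/-- The contribution of the functional `A` to the iterated bracket of `A`, `B` and `C`. -/
def bracketHess (μ : Measure (Spacetime N)) (A : Sec 𝒯.B → ℝ) (ζ : Sec 𝒯.E.dual) (φ : Sec 𝒯.B)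
    (χ : Cutoff d N) (a z b w : Sec 𝒯.B) : ℝ :=
  hess μ A ζ φ χ a w - hess μ A ζ φ χ z w + hess μ A ζ φ χ z b

/-- Each observable occurs in two iterated brackets with opposite signs and with the other two
observables interchanged; this symmetry cancels the two contributions. -/
theorem bracketHess_comm (hA : IsFunctional μ A) (ζ : Sec 𝒯.E.dual) (φ : Sec 𝒯.B) (χ : Cutoff d N)
    (a z b w : Sec 𝒯.B) : bracketHess μ A ζ φ χ a z b w = bracketHess μ A ζ φ χ b w a z := by
  rw [bracketHess, bracketHess, hess_comm hA ζ φ χ a w, hess_comm hA ζ φ χ z w,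
    hess_comm hA ζ φ χ z b]
  ring

variable [μ.IsOpenPosMeasure]

/-- The iterated bracket on shell in terms of Lagrange multipliers and fluctuations at a point. -/
theorem eventually_iterated_bracket (hregular : 𝒯.IsRegular) (hgauge : 𝒯.IsGaugeSymmetry)
    (hexact : 𝒯.IsExact σ) (hanchor : 𝒯.IsLagrangeStructure μ)
    {S : Sec 𝒯.B → Sec 𝒯.E.dual →ₗ[ℝ] Sec 𝒯.E.dual →ₗ[ℝ] Sec 𝒯.E.dual} (hSl : IsLocalBiop S)
    (hS : ∀ (φ : Sec 𝒯.B) (a b : Sec 𝒯.E.dual), IsCompact (supp a) → IsCompact (supp b) →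
      pair μ b (𝒯.J φ (𝒯.V φ a)) - pair μ a (𝒯.J φ (𝒯.V φ b)) = pair μ (S φ a b) (𝒯.T φ))
    (hφ : φ ∈ 𝒯.shell) (hA : 𝒯.IsObservable μ A) (hB : 𝒯.IsObservable μ B)
    (hC : 𝒯.IsObservable μ C) (hζA : 𝒯.IsMultiplier μ σ φ A ζA)
    (hζB : 𝒯.IsMultiplier μ σ φ B ζB) (hζC : 𝒯.IsMultiplier μ σ φ C ζC) {zA zB zC : Sec 𝒯.B}
    (hzA : 𝒯.IsResponse μ σ φ A zA) (hzB : 𝒯.IsResponse μ σ φ B zB)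
    (hzC : 𝒯.IsResponse μ σ φ C zC) {AB : Sec 𝒯.B → ℝ} (hAB : 𝒯.IsBracket μ σ A B AB)
    {U : Sec 𝒯.B → Sec 𝒯.B} (hU : 𝒯.IsFluctuation μ σ AB U) :
    ∀ᶠ χ in cutoffs d N, dirDeriv C φ (U φ) - dirDeriv AB φ zC =
      bracketHess μ B ζB φ χ (𝒯.V φ ζC) zC (𝒯.V φ ζA) zA -
      bracketHess μ A ζA φ χ (𝒯.V φ ζC) zC (𝒯.V φ ζB) zB -
      dirDeriv C φ (𝒯.V φ (S φ ζB ζA)) +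
      anchorDir A ζB φ (𝒯.V φ ζC) - anchorDir B ζA φ (𝒯.V φ ζC) := by
  obtain ⟨X, Y, hX, hY, hXY⟩ := hAB
  obtain rfl : AB = fun ψ => dirDeriv B ψ (X ψ) - dirDeriv A ψ (Y ψ) := funext hXY
  have hsX := hB.1.smoothFunctional.dirDeriv_along hX.1.1
  have hsY := hA.1.smoothFunctional.dirDeriv_along hY.1.1
  have hH : IsFunctional μ (fun ψ => dirDeriv B ψ (X ψ) - dirDeriv A ψ (Y ψ)) :=
    (hX.1.2.2 B hB.1).sub (hY.1.2.2 A hA.1)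
  obtain ⟨γ, hγ⟩ := exists_isShellCurve hregular hanchor hφ hζC hzC
  filter_upwards [eventually_dirDeriv_fluctuation hA.1 hB.1 hX hζB hγ,
    eventually_dirDeriv_fluctuation hB.1 hA.1 hY hζA hγ,
    eventually_hess_response hgauge hexact hφ hB hζB hγ (hX.isResponse hφ) hzA,
    eventually_hess_response hgauge hexact hφ hA hζA hγ (hY.isResponse hφ) hzB,
    eventually_anchorDir_response hSl hS hφ hA.1 hB.1 hC.1 hζA hζB hzC] with χ h1 h2 h3 h4 h5
  rw [dirDeriv_bracket_eq hφ hC.1 hH hζC hU, dirDeriv_sub_functional hsX hsY, h1, h2, h3, h4,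
    anchorDir_sub hA.1.smoothFunctional, anchorDir_sub hB.1.smoothFunctional,
    hess_sub_left hA.1, hess_sub_left hB.1, bracketHess, bracketHess]
  linarith

/-- The integrability of the anchor, contracted with the Lagrange multipliers of two functionals and
the derivative of a third one. -/
theorem anchorDir_sub_anchorDir
    {S : Sec 𝒯.B → Sec 𝒯.E.dual →ₗ[ℝ] Sec 𝒯.E.dual →ₗ[ℝ] Sec 𝒯.E.dual}
    {D : Sec 𝒯.B → Sec 𝒯.E.dual →ₗ[ℝ] Sec 𝒯.E.dual →ₗ[ℝ] Sec 𝒯.G}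
    {W : Sec 𝒯.B → Sec 𝒯.E.dual →ₗ[ℝ] Sec 𝒯.B.dual →ₗ[ℝ] Sec 𝒯.B} (hW : IsLocalBiop W)
    (hcomm : ∀ φ ∈ 𝒯.shell, ∀ (a b : Sec 𝒯.E.dual) (γ : Sec 𝒯.B.dual), IsCompact (supp γ) →
      pair μ γ (𝒯.anchorCommutator φ a b) =
        pair μ γ (𝒯.V φ (S φ a b)) + pair μ γ (𝒯.R φ (D φ a b))
          + pair μ a (𝒯.J φ (W φ b γ)) - pair μ b (𝒯.J φ (W φ a γ)))
    (hφ : φ ∈ 𝒯.shell) (hA : 𝒯.IsObservable μ A) (hζB : 𝒯.IsMultiplier μ σ φ B ζB)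
    (hζC : 𝒯.IsMultiplier μ σ φ C ζC) {α : Sec 𝒯.B.dual} (hα : IsCompact (supp α))
    (hgrad : ∀ X : Sec 𝒯.B, dirDeriv A φ X = pair μ α X) :
    anchorDir A ζB φ (𝒯.V φ ζC) - anchorDir A ζC φ (𝒯.V φ ζB) -
      dirDeriv A φ (𝒯.V φ (S φ ζC ζB)) =
        dirDeriv C φ (W φ ζB α) - dirDeriv B φ (W φ ζC α) := by
  have h := hcomm φ hφ ζC ζB α hα
  have hsec : 𝒯.anchorCommutator φ ζC ζB =
      (((𝒯.V_local.smoothMap ζB).dir φ (𝒯.V φ ζC) -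
        (𝒯.V_local.smoothMap ζC).dir φ (𝒯.V φ ζB) : Sec 𝒯.B) : ∀ x, 𝒯.B.fib x) := rfl
  have hWc : ∀ a, IsCompact (supp (W φ a α)) := fun a =>
    hα.of_isClosed_subset (isClosed_supp _) (hW.supp_subset_right φ a α)
  rw [hsec, ← hgrad, ← hgrad, ← hgrad, dirDeriv_gauge hA hφ, hA.1.smoothFunctional.dirDeriv_sub,
    ← hζC.dirDeriv_eq _ (hWc ζB), ← hζB.dirDeriv_eq _ (hWc ζC)] at h
  -- The second derivatives of `A` cancel by symmetry, leaving the commutator of the anchor fields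
  -- applied to `A`.
  rw [anchorDir_eq hA.1.smoothFunctional, anchorDir_eq hA.1.smoothFunctional,
    hA.1.smoothFunctional.dirDeriv₂_comm φ (𝒯.V φ ζB)]
  linarith

/-- The Jacobi identity for the advanced and retarded brackets of physical observables. -/
theorem bracket_jacobi
    (hregular : 𝒯.IsRegular) (hgauge : 𝒯.IsGaugeSymmetry) (hexact : 𝒯.IsExact σ)
    (hdual : 𝒯.IsDualExact μ σ.op) (hanchor : 𝒯.IsLagrangeStructure μ)
    (hA : 𝒯.IsObservable μ A) (hB : 𝒯.IsObservable μ B) (hC : 𝒯.IsObservable μ C)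
    {AB BC CA AB_C BC_A CA_B : Sec 𝒯.B → ℝ}
    (hAB : 𝒯.IsBracket μ σ A B AB) (hBC : 𝒯.IsBracket μ σ B C BC) (hCA : 𝒯.IsBracket μ σ C A CA)
    (hAB_C : 𝒯.IsBracket μ σ AB C AB_C) (hBC_A : 𝒯.IsBracket μ σ BC A BC_A)
    (hCA_B : 𝒯.IsBracket μ σ CA B CA_B) (hφ : φ ∈ 𝒯.shell) :
    AB_C φ + BC_A φ + CA_B φ = 0 := by
  obtain ⟨ζA, hζA⟩ := hA.exists_isMultiplier hdual hφ
  obtain ⟨ζB, hζB⟩ := hB.exists_isMultiplier hdual hφ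
  obtain ⟨ζC, hζC⟩ := hC.exists_isMultiplier hdual hφ
  obtain ⟨S, D, W, hSl, -, hWl, hS, hWsymm, hcomm⟩ := id hanchor
  obtain ⟨UAB, ZC, hUAB, hZC, hABC⟩ := hAB_C
  obtain ⟨UBC, ZA, hUBC, hZA, hBCA⟩ := hBC_A
  obtain ⟨UCA, ZB, hUCA, hZB, hCAB⟩ := hCA_B
  have hzA := hZA.isResponse hφ
  have hzB := hZB.isResponse hφ
  have hzC := hZC.isResponse hφ
  obtain ⟨α, hα, hgα⟩ := hA.1.exists_gradient_at φ
  obtain ⟨β, hβ, hgβ⟩ := hB.1.exists_gradient_at φ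
  obtain ⟨κ, hκ, hgκ⟩ := hC.1.exists_gradient_at φ
  -- One common cutoff is needed: the Hessian terms of different brackets cancel only for the same
  -- `χ`.
  obtain ⟨χ, h1, h2, h3⟩ :=
    ((eventually_iterated_bracket hregular hgauge hexact hanchor hSl hS hφ hA hB hC
      hζA hζB hζC hzA hzB hzC hAB hUAB).and
    ((eventually_iterated_bracket hregular hgauge hexact hanchor hSl hS hφ hB hC hA
      hζB hζC hζA hzB hzC hzA hBC hUBC).and
    (eventually_iterated_bracket hregular hgauge hexact hanchor hSl hS hφ hC hA hB
      hζC hζA hζB hzC hzA hzB hCA hUCA))).exists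
  have w1 := anchorDir_sub_anchorDir hWl hcomm hφ hA hζB hζC hα hgα
  have w2 := anchorDir_sub_anchorDir hWl hcomm hφ hB hζC hζA hβ hgβ
  have w3 := anchorDir_sub_anchorDir hWl hcomm hφ hC hζA hζB hκ hgκ
  -- Each multiplier enters two of the six `W` terms, with opposite signs and with the other two
  -- gradients exchanged.
  have s1 := hWsymm φ hφ ζA β κ hβ hκ
  have s2 := hWsymm φ hφ ζB κ α hκ hα
  have s3 := hWsymm φ hφ ζC α β hα hβ
  simp only [hgα (W φ _ _), hgβ (W φ _ _), hgκ (W φ _ _)] at w1 w2 w3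
  rw [hABC, hBCA, hCAB, h1, h2, h3,
    bracketHess_comm hA.1 ζA φ χ (𝒯.V φ ζC) _ (𝒯.V φ ζB),
    bracketHess_comm hB.1 ζB φ χ (𝒯.V φ ζA) _ (𝒯.V φ ζC),
    bracketHess_comm hC.1 ζC φ χ (𝒯.V φ ζB) _ (𝒯.V φ ζA)]
  linarith

end FieldTheory

end CovariantBracket

end

theorem proposition4p3 {d : ℕ} {N : Type*} [TopologicalSpace N] [T2Space N]
    [SecondCountableTopology N] [ChartedSpace (EuclideanSpace ℝ (Fin d)) N]
    [IsManifold (𝓡 d) ∞ N] [MeasurableSpace N] [BorelSpace N]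
    (μ : Measure (ℝ × N)) [IsFiniteMeasureOnCompacts μ] [μ.IsOpenPosMeasure]
    (𝒯 : CovariantBracket.FieldTheory d N)
    (hregular : 𝒯.IsRegular)
    (hgauge : 𝒯.IsGaugeSymmetry)
    (hexact : ∀ σ, 𝒯.IsExact σ)
    (hdual : ∀ σ, 𝒯.IsDualExact μ σ)
    (hanchor : 𝒯.IsLagrangeStructure μ)
    (σ : CovariantBracket.Dir)
    (A B C : CovariantBracket.Sec 𝒯.B → ℝ)
    (hA : 𝒯.IsObservable μ A) (hB : 𝒯.IsObservable μ B) (hC : 𝒯.IsObservable μ C)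
    (AB BC CA AB_C BC_A CA_B : CovariantBracket.Sec 𝒯.B → ℝ)
    (hAB : 𝒯.IsBracket μ σ A B AB) (hBC : 𝒯.IsBracket μ σ B C BC)
    (hCA : 𝒯.IsBracket μ σ C A CA)
    (hAB_C : 𝒯.IsBracket μ σ AB C AB_C) (hBC_A : 𝒯.IsBracket μ σ BC A BC_A)
    (hCA_B : 𝒯.IsBracket μ σ CA B CA_B) :
    ∀ φ ∈ 𝒯.shell, AB_C φ + BC_A φ + CA_B φ = 0 := by
  exact fun φ hφ => CovariantBracket.FieldTheory.bracket_jacobi hregular hgauge (hexact σ)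
    (hdual σ.op) hanchor hA hB hC hAB hBC hCA hAB_C hBC_A hCA_B hφ
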